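/- Let $n\ge 3$, and let $\Gamma_n=\langle b_1,\dots,b_n \mid b_1^2=\cdots=b_n^2=1\rangle$ act on $\mathbb{C}^n$ by $$b_i(x_1,\dots,x_n)=\Big(x_1,\dots,x_{i-1},\ \prod_{j\ne i}x_j-x_i,\ x_{i+1},\dots,x_n\Big).$$ Let $\Delta$ be the Cayley graph of $\Gamma_n$: its vertices are the elements of $\Gamma_n$, and $g,h$ are joined by an edge labelled $i$ if and only if $g=hb_i$. For a two-element set $\{i,j\}\subset\{1,\dots,n\}$, an alternating geodesic with labels $\{i,j\}$ is a connected component of the graph obtained from $\Delta$ by removing all edges whose label is not in $\{i,j\}$; let $\mathcal{A}$ be the set of all alternating geodesics, for all pairs $\{i,j\}$. Every $\mathbf{a}\in\mathbb{C}^n$ induces a map $\phi_{\mathbf{a}}:\mathcal{A}\to\mathbb{C}$: if $\gamma$ has labels $\{i,j\}$, $g$ is any vertex of $\gamma$, and $g^{-1}(\mathbf{a})=(x_1,\dots,x_n)$, then $\phi_{\mathbf{a}}(\gamma)=\prod_{k\ne i,j}x_k$ (this does not depend on the choice of $g$). Let $\mathcal{D}$ be the set of all $\mathbf{a}\in\mathbb{C}^n$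 such that (i) $\phi_{\mathbf{a}}(\gamma)\notin[-2,2]$ for all $\gamma\in\mathcal{A}$; and (ii) for some real $K>2$, the set $\{\gamma\in\mathcal{A} : |\phi_{\mathbf{a}}(\gamma)|\le K\}$ is finite. Then $\mathcal{D}$ is a non-empty open subset of $\mathbb{C}^n$, it is invariant under $\Gamma_n$ (that is, $g\mathcal{D}=\mathcal{D}$ for all $g\in\Gamma_n$), and $\Gamma_n$ acts properly discontinuously on $\mathcal{D}$: for every compact set $C\subset\mathcal{D}$, the set $\{g\in\Gamma_n : gC\cap C\neq\emptyset\}$ is finite. Furthermore, $\mathbf{0}\in\mathbb{C}^n$ does not lie in the closure of $\mathcal{D}$. -/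

import Mathlib

namespace MarkoffHurwitz

/-- The set of relators `b_i ^ 2`, `i = 1, …, n`. -/
def relators (n : ℕ) : Set (FreeGroup (Fin n)) :=
  Set.range fun i => FreeGroup.of i ^ 2

/-- The group `Γ_n = ⟨ b_1, …, b_n ∣ b_1 ^ 2 = ⋯ = b_n ^ 2 = 1 ⟩`. -/
abbrev Gam (n : ℕ) : Type := PresentedGroup (relators n)

/-- The generator `b_i` of `Γ_n`. -/
def gen {n : ℕ} (i : Fin n) : Gam n := PresentedGroup.of i

theorem gen_mul_self {n : ℕ} (i : Fin n) : gen i * gen i = 1 := by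
  have h : PresentedGroup.mk (relators n) (FreeGroup.of i ^ 2) = 1 :=
    PresentedGroup.one_of_mem ⟨i, rfl⟩
  simpa [pow_two, gen, PresentedGroup.of] using h

/-- The map `b_i` of `ℂⁿ`: it fixes the coordinates `x_j`, `j ≠ i`, and replaces `x_i` by
`∏_{j ≠ i} x_j - x_i`. -/
def flipMap {n : ℕ} (i : Fin n) (x : Fin n → ℂ) : Fin n → ℂ :=
  Function.update x i (∏ j ∈ Finset.univ.erase i, x j - x i)

theorem flipMap_involutive {n : ℕ} (i : Fin n) : Function.Involutive (flipMap i) := by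
  intro x
  have h : ∏ j ∈ Finset.univ.erase i, flipMap i x j = ∏ j ∈ Finset.univ.erase i, x j :=
    Finset.prod_congr rfl fun j hj => by simp [flipMap, Finset.ne_of_mem_erase hj]
  funext k
  by_cases hk : k = i
  · subst hk
    rw [flipMap, Function.update_self, h]
    simp [flipMap]
  · simp [flipMap, hk]

/-- The homomorphism from `Γ_n` to the bijections of `ℂⁿ` which sends each generator `b_i` to
the map `b_i`. -/
def actionHom (n : ℕ) : Gam n →* Equiv.Perm (Fin n → ℂ) :=
  PresentedGroup.toGroup (f := fun i => (flipMap_involutive i).toPerm (flipMap i)) (by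
    rintro _ ⟨i, rfl⟩
    ext1 x
    simpa [pow_two] using flipMap_involutive i x)

/-- The action of `Γ_n` on `ℂⁿ`. -/
instance instMulActionGam (n : ℕ) : MulAction (Gam n) (Fin n → ℂ) :=
  MulAction.compHom (Fin n → ℂ) (actionHom n)

theorem gen_smul {n : ℕ} (i : Fin n) (x : Fin n → ℂ) : gen i • x = flipMap i x := by
  change actionHom n (gen i) x = _
  simp [actionHom, gen]

/-- The spanning subgraph of the Cayley graph `Δ` of `Γ_n` which consists of the edges with a
label in `I`; `g` and `h` are joined by an edge with label `i` if and only if `g = h * b_i`.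
The Cayley graph `Δ` itself is the case where `I` is the set of all labels. -/
def labelGraph {n : ℕ} (I : Finset (Fin n)) : SimpleGraph (Gam n) where
  Adj g h := g ≠ h ∧ ∃ i ∈ I, g = h * gen i
  symm := ⟨by
    rintro g h ⟨hne, i, hi, rfl⟩
    exact ⟨hne.symm, i, hi, by rw [mul_assoc, gen_mul_self, mul_one]⟩⟩
  loopless := ⟨fun _ h => h.1 rfl⟩

/-- The set `𝒜` of alternating geodesics. An alternating geodesic with labels in the two-element
set `I = {i, j}` is a connected component of what remains of the tree `Δ` when all the edges with
a label outside `I` are removed, and `𝒜` is the disjoint union over all the sets `I`. -/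
abbrev AltGeodesic (n : ℕ) : Type :=
  Σ I : {I : Finset (Fin n) // I.card = 2}, (labelGraph I.1).ConnectedComponent

/-- The vector-valued Hurwitz map `Φ_a : V(Δ) → ℂⁿ`, `Φ_a(g) = g⁻¹(a)`. -/
def vecHurwitz {n : ℕ} (a : Fin n → ℂ) (g : Gam n) : Fin n → ℂ := g⁻¹ • a

/-- Along an edge with label in `I`, the coordinates of `Φ_a` outside `I` do not change. -/
theorem vecHurwitz_eq_of_adj {n : ℕ} (a : Fin n → ℂ) {I : Finset (Fin n)} {g h : Gam n}
    (hgh : (labelGraph I).Adj g h) {k : Fin n} (hk : k ∉ I) :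
    vecHurwitz a g k = vecHurwitz a h k := by
  obtain ⟨-, i, hi, rfl⟩ := hgh
  have hinv : (gen i : Gam n)⁻¹ = gen i := inv_eq_of_mul_eq_one_left (gen_mul_self i)
  have hki : k ≠ i := fun e => hk (e ▸ hi)
  simp [vecHurwitz, mul_smul, hinv, gen_smul, flipMap, hki]

/-- The extended Hurwitz map `φ_a : 𝒜 → ℂ`: for an alternating geodesic `γ` with set of labels
`I = {i, j}` and any vertex `g` of `γ`, with `Φ_a(g) = (x_1, …, x_n)`, its value is
`φ_a(γ) = ∏_{k ≠ i, j} x_k`. -/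
def extHurwitz {n : ℕ} (a : Fin n → ℂ) (γ : AltGeodesic n) : ℂ :=
  γ.2.lift (fun g => ∏ k ∈ γ.1.1ᶜ, vecHurwitz a g k) (by
    intro v w p hp
    clear hp
    induction p with
    | nil => rfl
    | cons hadj _ ih =>
      exact (Finset.prod_congr rfl fun k hk =>
        vecHurwitz_eq_of_adj a hadj (Finset.mem_compl.mp hk)).trans ih)

theorem extHurwitz_mk {n : ℕ} (a : Fin n → ℂ) (I : {I : Finset (Fin n) // I.card = 2})
    (g : Gam n) :
    extHurwitz a ⟨I, (labelGraph I.1).connectedComponentMk g⟩ =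
      ∏ k ∈ I.1ᶜ, vecHurwitz a g k := rfl

/-- The set `𝒟 ⊆ ℂⁿ` of all `a` for which `φ_a` satisfies the Bowditch conditions:
(i) `φ_a(γ)` is not in the real interval `[-2, 2]` for any `γ`;
(ii) for some `K > 2` there are only finitely many `γ` with `|φ_a(γ)| ≤ K`. -/
def bowditchDomain (n : ℕ) : Set (Fin n → ℂ) :=
  {a | (∀ γ : AltGeodesic n, extHurwitz a γ ∉ Complex.ofReal '' Set.Icc (-2 : ℝ) 2) ∧
    ∃ K : ℝ, 2 < K ∧ {γ : AltGeodesic n | ‖extHurwitz a γ‖ ≤ K}.Finite}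

end MarkoffHurwitz

/-! ### Reduced words as normal forms, and the base vertex of an alternating geodesic -/

namespace MarkoffHurwitz

/-! Vertices of the Cayley graph are reduced words, and `pt a w` is the image of `a` after the flips
of `w`. The heart of the proof is the condition `Escape`, which is open in the point, is inherited
under every flip except undoing the last one, and makes the newest coordinate grow by a factor `ρ >
1` per flip. It is the union of `Good` (the newest coordinate dominates and all products involving
its label exceed `K`) and `Tail` (the point is far out on a geodesic whose value `l + l⁻¹`, perhaps
small, has `‖l‖ > ρ`, so that the two moving coordinates have ratio close to `l`).

If all reduced words of one length escape, then a geodesic whose base is longer has value larger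
than `K`. So condition (ii) follows, and (i) need only be checked on finitely many products
(`mem_bowditchDomain_of_escapesAt`). Conversely, every point of the domain escapes at some length
(`exists_escapesAt`): along each of the finitely many small geodesics the coordinates follow a
linear recurrence and end up in `Tail`; elsewhere a failure of `Good` would propagate back to the
root with the products growing geometrically, which is impossible for long words. Thus membership is
witnessed by finitely many open conditions. This gives openness and locally uniform exponential
growth of the orbit, hence proper discontinuity. Invariance is left translation of geodesics.

For the origin, suppose that `a` in the domain is close to `0`. The polynomial `hurwitz` is
invariant and small, so near the origin the squares of the coordinates nearly cancel unless the
point is much closer still. If so, two coordinates partly cancel, and moving along their geodesic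
lowers `energy`; if the point is closer still, any flip is harmless. Either way a longer word keeps
the orbit in the same small ball (`exists_longer_of_energy_le`), contradicting the finiteness of
bounded parts of the orbit. -/

/-- A word without two equal consecutive letters. -/
abbrev Reduced {n : ℕ} (l : List (Fin n)) : Prop := l.IsChain (· ≠ ·)

/-- Put a letter in front of a word, and cancel it if the word already starts with it. -/
def cancelCons {n : ℕ} (i : Fin n) : List (Fin n) → List (Fin n)
  | [] => [i]
  | j :: t => if i = j then t else i :: j :: t

theorem Reduced.cancelCons {n : ℕ} (i : Fin n) {l : List (Fin n)} (h : Reduced l) :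
    Reduced (cancelCons i l) := by
  cases l with
  | nil => exact List.isChain_singleton i
  | cons j t =>
    by_cases hij : i = j
    · simpa [MarkoffHurwitz.cancelCons, hij] using h.tail
    · simpa [MarkoffHurwitz.cancelCons, hij] using List.isChain_cons_cons.mpr ⟨hij, h⟩

theorem cancelCons_of_reduced {n : ℕ} {i : Fin n} {l : List (Fin n)} (h : Reduced (i :: l)) :
    cancelCons i l = i :: l := by
  cases l with
  | nil => rfl
  | cons j t => simp [cancelCons, (List.isChain_cons_cons.mp h).1]

theorem cancelCons_cancelCons {n : ℕ} (i : Fin n) {l : List (Fin n)} (h : Reduced l) :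
    cancelCons i (cancelCons i l) = l := by
  cases l with
  | nil => simp [cancelCons]
  | cons j t =>
    by_cases hij : i = j
    · subst hij
      simpa [cancelCons] using cancelCons_of_reduced h
    · simp [cancelCons, hij]

/-- The action of a generator on the reduced words. -/
def reducedPerm {n : ℕ} (i : Fin n) : Equiv.Perm {l : List (Fin n) // Reduced l} :=
  Function.Involutive.toPerm (fun l => ⟨cancelCons i l.1, l.2.cancelCons i⟩)
    fun l => Subtype.ext (cancelCons_cancelCons i l.2)

/-- The action of `Γ_n` on the reduced words. -/
def reducedHom (n : ℕ) : Gam n →* Equiv.Perm {l : List (Fin n) // Reduced l} :=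
  PresentedGroup.toGroup (f := reducedPerm) (by
    rintro _ ⟨i, rfl⟩
    ext1 x
    have h : reducedPerm i (reducedPerm i x) = x :=
      Subtype.ext (cancelCons_cancelCons i x.2)
    simpa [pow_two] using h)

theorem gen_inv {n : ℕ} (i : Fin n) : (gen i : Gam n)⁻¹ = gen i :=
  inv_eq_of_mul_eq_one_left (gen_mul_self i)

/-- The element of `Γ_n` spelled by a word, the head of the list being the last letter. -/
def ev {n : ℕ} : List (Fin n) → Gam n
  | [] => 1
  | i :: l => ev l * gen i

/-- The reduced word which spells an element of `Γ_n`. -/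
def nf {n : ℕ} (g : Gam n) : List (Fin n) := (reducedHom n g⁻¹ ⟨[], List.isChain_nil⟩).1

theorem nf_reduced {n : ℕ} (g : Gam n) : Reduced (nf g) :=
  (reducedHom n g⁻¹ ⟨[], List.isChain_nil⟩).2

theorem nf_mul_gen {n : ℕ} (g : Gam n) (i : Fin n) : nf (g * gen i) = cancelCons i (nf g) := by
  have h : reducedHom n (gen i) = reducedPerm i := by simp [reducedHom, gen]
  simp only [nf, mul_inv_rev, gen_inv, map_mul, h]
  rfl

/-- Van der Waerden's argument: letting the group act on reduced words shows that distinct reduced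
words spell distinct elements. -/
theorem nf_ev {n : ℕ} {l : List (Fin n)} (h : Reduced l) : nf (ev l) = l := by
  induction l with
  | nil => simp [nf, ev]
  | cons i l ih => rw [ev, nf_mul_gen, ih h.tail, cancelCons_of_reduced h]

theorem ev_cancelCons {n : ℕ} (i : Fin n) (l : List (Fin n)) :
    ev (cancelCons i l) = ev l * gen i := by
  cases l with
  | nil => rfl
  | cons j t =>
    by_cases hij : i = j
    · subst hij
      simp [cancelCons, ev, mul_assoc, gen_mul_self]
    · simp [cancelCons, ev, hij]

theorem ev_nf {n : ℕ} (g : Gam n) : ev (nf g) = g := by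
  have hg : g ∈ Subgroup.closure (Set.range (PresentedGroup.of (rels := relators n))) := by
    rw [PresentedGroup.closure_range_of]; trivial
  induction hg using Subgroup.closure_induction_right with
  | one => simp [nf, ev]
  | mul_right x _ y hy ih =>
    obtain ⟨i, rfl⟩ := hy
    exact (congrArg ev (nf_mul_gen x i)).trans ((ev_cancelCons _ _).trans (by rw [ih]; rfl))
  | mul_inv_cancel x _ y hy ih =>
    obtain ⟨i, rfl⟩ := hy
    have : (PresentedGroup.of i : Gam n)⁻¹ = gen i := gen_inv i
    rw [this]
    exact (congrArg ev (nf_mul_gen x i)).trans ((ev_cancelCons _ _).trans (by rw [ih]))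

/-- The image of `a` after the flips spelled by a word, the head of the list acting last. -/
def pt {n : ℕ} (a : Fin n → ℂ) : List (Fin n) → Fin n → ℂ
  | [] => a
  | i :: l => flipMap i (pt a l)

theorem vecHurwitz_ev {n : ℕ} (a : Fin n → ℂ) (l : List (Fin n)) :
    vecHurwitz a (ev l) = pt a l := by
  induction l with
  | nil => simp [vecHurwitz, ev, pt]
  | cons i l ih =>
    rw [pt, ← ih]
    simp [vecHurwitz, ev, mul_smul, gen_inv, gen_smul]

theorem connectedComponentMk_mul_gen {n : ℕ} {I : Finset (Fin n)} (g : Gam n) {i : Fin n}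
    (hi : i ∈ I) : (labelGraph I).connectedComponentMk (g * gen i) =
      (labelGraph I).connectedComponentMk g := by
  by_cases h : g * gen i = g
  · rw [h]
  · exact SimpleGraph.ConnectedComponent.sound (SimpleGraph.Adj.reachable ⟨h, i, hi, rfl⟩)

theorem connectedComponentMk_dropWhile {n : ℕ} (I : Finset (Fin n)) (l : List (Fin n)) :
    (labelGraph I).connectedComponentMk (ev (l.dropWhile (· ∈ I))) =
      (labelGraph I).connectedComponentMk (ev l) := by
  induction l with
  | nil => rfl
  | cons i l ih =>
    by_cases hi : i ∈ I
    · rw [List.dropWhile_cons_of_pos (by simpa using hi), ih, ev,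
        connectedComponentMk_mul_gen _ hi]
    · rw [List.dropWhile_cons_of_neg (by simpa using hi)]

theorem dropWhile_cancelCons {n : ℕ} {I : Finset (Fin n)} {i : Fin n} (hi : i ∈ I)
    (l : List (Fin n)) :
    (cancelCons i l).dropWhile (· ∈ I) = l.dropWhile (· ∈ I) := by
  cases l with
  | nil => simp [cancelCons, hi]
  | cons j t =>
    by_cases hij : i = j
    · subst hij
      simp [cancelCons, hi]
    · simp [cancelCons, hi, hij]

/-- The reduced word of the vertex of an alternating geodesic which is closest to `1`. -/
def base {n : ℕ} (γ : AltGeodesic n) : List (Fin n) :=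
  γ.2.lift (fun g => (nf g).dropWhile (· ∈ γ.1.1)) (by
    intro v w p hp
    clear hp
    induction p with
    | nil => rfl
    | cons hadj _ ih =>
      refine Eq.trans ?_ ih
      obtain ⟨-, i, hi, rfl⟩ := hadj
      rw [nf_mul_gen, dropWhile_cancelCons hi])

theorem base_mk {n : ℕ} (I : {I : Finset (Fin n) // I.card = 2}) {l : List (Fin n)}
    (hl : Reduced l) :
    base ⟨I, (labelGraph I.1).connectedComponentMk (ev l)⟩ = l.dropWhile (· ∈ I.1) := by
  change (nf (ev l)).dropWhile _ = _
  rw [nf_ev hl]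

theorem Reduced.dropWhile {n : ℕ} {l : List (Fin n)} (h : Reduced l) (p : Fin n → Bool) :
    Reduced (l.dropWhile p) :=
  List.IsChain.suffix h (l.dropWhile_suffix p)

theorem base_reduced {n : ℕ} (γ : AltGeodesic n) : Reduced (base γ) := by
  obtain ⟨I, c⟩ := γ
  induction c using SimpleGraph.ConnectedComponent.ind with
  | h g =>
    exact (nf_reduced g).dropWhile _

theorem mk_base {n : ℕ} (γ : AltGeodesic n) :
    γ = ⟨γ.1, (labelGraph γ.1.1).connectedComponentMk (ev (base γ))⟩ := by
  obtain ⟨I, c⟩ := γ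
  induction c using SimpleGraph.ConnectedComponent.ind with
  | h g =>
    have : base ⟨I, (labelGraph I.1).connectedComponentMk g⟩ = (nf g).dropWhile (· ∈ I.1) := rfl
    rw [this, connectedComponentMk_dropWhile, ev_nf]

/-- The base is reached by a flip transversal to the geodesic; this is what lets `Escape` at the
base bound the value on the geodesic. -/
theorem base_eq_cons {n : ℕ} {γ : AltGeodesic n} {i : Fin n} {l : List (Fin n)}
    (h : base γ = i :: l) : i ∉ γ.1.1 := by
  obtain ⟨I, c⟩ := γ
  induction c using SimpleGraph.ConnectedComponent.ind with
  | h g =>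
    have h' : (nf g).dropWhile (· ∈ I.1) = i :: l := h
    have := List.head_dropWhile_not (fun j => decide (j ∈ I.1)) (l := nf g) (by simp [h'])
    simpa [h'] using this

end MarkoffHurwitz

/-! ### Escaping points: an open condition that propagates outwards -/

namespace MarkoffHurwitz

/-- The product of all coordinates except the `i`-th and the `j`-th. -/
noncomputable def cof {n : ℕ} (x : Fin n → ℂ) (i j : Fin n) : ℂ :=
  ∏ k ∈ ({i, j} : Finset (Fin n))ᶜ, x k

/-- The product of all coordinates except the `i`-th. -/
noncomputable def cop {n : ℕ} (x : Fin n → ℂ) (i : Fin n) : ℂ :=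
  ∏ k ∈ Finset.univ.erase i, x k

section Products

variable {n : ℕ} {x : Fin n → ℂ} {i j k : Fin n}

theorem cof_comm (x : Fin n → ℂ) (i j : Fin n) : cof x i j = cof x j i := by
  rw [cof, cof, Finset.pair_comm]

theorem cop_eq (x : Fin n → ℂ) (h : j ≠ i) : cop x i = cof x i j * x j := by
  rw [cop, ← Finset.mul_prod_erase _ _ (Finset.mem_erase.mpr ⟨h, Finset.mem_univ j⟩), mul_comm,
    cof]
  congr 2
  ext k
  simp [and_comm]

theorem cof_eq (x : Fin n → ℂ) (hi : i ≠ k) (hj : j ≠ k) :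
    cof x i j = x k * ∏ l ∈ ({i, j, k} : Finset (Fin n))ᶜ, x l := by
  rw [cof, ← Finset.mul_prod_erase _ _ (a := k) (by simp [hi.symm, hj.symm])]
  congr 2
  ext l
  simp
  tauto

theorem flipMap_self (x : Fin n → ℂ) (i : Fin n) : flipMap i x i = cop x i - x i := by
  simp [flipMap, cop]

theorem flipMap_of_ne (x : Fin n → ℂ) (h : k ≠ i) : flipMap i x k = x k := by
  simp [flipMap, h]

theorem cof_flipMap_left (x : Fin n → ℂ) (i j : Fin n) : cof (flipMap i x) i j = cof x i j :=
  Finset.prod_congr rfl fun k hk => flipMap_of_ne x (by simp at hk; tauto)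

theorem cop_flipMap (x : Fin n → ℂ) (i : Fin n) : cop (flipMap i x) i = cop x i :=
  Finset.prod_congr rfl fun k hk => flipMap_of_ne x (by simp at hk; tauto)

end Products

/-- The `i`-th coordinate dominates, and the products over the alternating geodesics whose label
contains `i` are large. -/
def Good {n : ℕ} (K : ℝ) (x : Fin n → ℂ) (i : Fin n) : Prop :=
  ‖cop x i‖ < 2 * ‖x i‖ ∧ ∀ j, j ≠ i → K < ‖cof x i j‖

/-- The point lies far out on an alternating geodesic with labels `i`, `j` along which the
coordinates grow exponentially, and leaving this geodesic leads to points which are `Good`. -/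
def Tail {n : ℕ} (K ρ : ℝ) (x : Fin n → ℂ) (i : Fin n) : Prop :=
  ∃ j, j ≠ i ∧ ∃ (l : ℂ) (ε δ : ℝ), ρ + ε ≤ ‖l‖ ∧ δ + ε / ρ ^ 2 ≤ ε ∧
    ‖x i - l * x j‖ < ε * ‖x j‖ ∧ ‖cof x i j - (l + l⁻¹)‖ < δ ∧
    ∀ k, k ≠ i → k ≠ j → 2 * ‖x k‖ < ‖cop x k‖ ∧ ∀ m, m ≠ k → K < ‖cof x k m‖

/-- All further flips, starting with one different from `i`, let the coordinates grow. -/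
def Escape {n : ℕ} (K ρ : ℝ) (x : Fin n → ℂ) (i : Fin n) : Prop :=
  Good K x i ∨ Tail K ρ x i

section Escape

variable {n : ℕ} {x : Fin n → ℂ} {i j k : Fin n} {K ρ : ℝ}

theorem Good.dominates (h : Good K x i) (hj : j ≠ i) : K / 2 * ‖x j‖ ≤ ‖x i‖ := by
  have h1 := h.1
  rw [cop_eq x hj, norm_mul] at h1
  nlinarith [h.2 j hj, norm_nonneg (x j)]

theorem Good.lt_norm_cof (hK : 2 ≤ K) (h : Good K x i) (hj : j ≠ i) (hk : k ≠ i) (hjk : j ≠ k) :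
    K < ‖cof x j k‖ := by
  have h1 := h.2 k hk
  have h2 := h.dominates hj
  rw [cof_eq x hj.symm hjk.symm] at h1
  rw [cof_eq x hj hk]
  have e : ({j, k, i} : Finset (Fin n)) = {i, k, j} := by ext; simp; tauto
  rw [e, norm_mul]
  rw [norm_mul] at h1
  refine h1.trans_le (mul_le_mul_of_nonneg_right ?_ (norm_nonneg _))
  nlinarith [norm_nonneg (x j)]

/-- Since `x i` dominates `x j`, the product `cof x i j * x i` outweighs `x j` in the new
coordinate, and exchanging `x j` for `x i` in a product only enlarges it. -/
theorem Good.flip (hK : 2 < K) (h : Good K x i) (hj : j ≠ i) : Good K (flipMap j x) j := by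
  have h2 := h.2 j hj
  have h1 := h.dominates hj
  have hx : 0 < ‖x i‖ := by linarith [h.1, norm_nonneg (cop x i)]
  refine ⟨?_, fun k hk => ?_⟩
  · rw [cop_flipMap, flipMap_self, cop_eq x hj.symm, norm_mul, cof_comm]
    have h3 := norm_sub_norm_le (cof x i j * x i) (x j)
    rw [norm_mul] at h3
    nlinarith [norm_nonneg (x j)]
  · rw [cof_flipMap_left]
    rcases eq_or_ne k i with rfl | hki
    · rwa [cof_comm]
    · exact h.lt_norm_cof hK.le hj hki hk.symm

theorem Tail.flip (hK : 2 * ρ ≤ K) (hρ : 1 < ρ) (h : Tail K ρ x i) (hj : j ≠ i) :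
    Escape K ρ (flipMap j x) j ∧ ρ * ‖x i‖ ≤ ‖flipMap j x j‖ := by
  obtain ⟨p, hp, l, ε, δ, hl, hδ, hx, hc, hex⟩ := h
  rcases eq_or_ne j p with rfl | hjp
  · have hxj : 0 < ‖x j‖ := by
      rcases (norm_nonneg (x j)).eq_or_lt with h0 | h0
      · rw [← h0, mul_zero] at hx
        exact absurd hx (norm_nonneg _).not_gt
      · exact h0
    have hε : 0 < ε := pos_of_mul_pos_left ((norm_nonneg _).trans_lt hx) hxj.le
    have hl0 : l ≠ 0 := by rintro rfl; simp at hl; linarith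
    have hdom : ρ * ‖x j‖ ≤ ‖x i‖ := by
      have h3 := norm_sub_norm_le (l * x j) (l * x j - x i)
      rw [sub_sub_cancel, norm_sub_rev (l * x j), norm_mul] at h3
      nlinarith
    have hxi : 0 < ‖x i‖ := lt_of_lt_of_le (by positivity) hdom
    have hnew : ‖flipMap j x j - l * x i‖ < ε * ‖x i‖ := by
      -- The old error is contracted by `l⁻¹`, and by a further `ρ⁻¹` because it is now measured
      -- against `x i`; the deviation of the product from `l + l⁻¹` adds `δ`. The constraint `δ + ε
      -- / ρ ^ 2 ≤ ε` restores the bound.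
      have e : flipMap j x j - l * x i =
          (cof x i j - (l + l⁻¹)) * x i + l⁻¹ * (x i - l * x j) := by
        rw [flipMap_self, cop_eq x hj.symm, cof_comm]
        field_simp
        ring
      rw [e]
      refine (norm_add_le _ _).trans_lt ?_
      rw [norm_mul, norm_mul, norm_inv]
      have h1 : ‖cof x i j - (l + l⁻¹)‖ * ‖x i‖ < δ * ‖x i‖ := by gcongr
      have h2 : ‖l‖⁻¹ * ‖x i - l * x j‖ ≤ ρ⁻¹ * (ε * (ρ⁻¹ * ‖x i‖)) := by
        gcongr ?_ * ?_
        · exact inv_anti₀ (by linarith) (by linarith)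
        · refine hx.le.trans ?_
          gcongr
          rw [le_inv_mul_iff₀ (by linarith)]
          exact hdom
      have h3 : ρ⁻¹ * (ε * (ρ⁻¹ * ‖x i‖)) = ε / ρ ^ 2 * ‖x i‖ := by
        field_simp
      nlinarith
    have hdom' : ρ * ‖x i‖ ≤ ‖flipMap j x j‖ := by
      have h3 := norm_sub_norm_le (l * x i) (l * x i - flipMap j x j)
      rw [sub_sub_cancel, norm_sub_rev (l * x i), norm_mul] at h3
      nlinarith
    -- No coordinate shrinks, so the lower bounds for the transversal labels persist.
    have hle : ∀ m, ‖x m‖ ≤ ‖flipMap j x m‖ := by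
      intro m
      rcases eq_or_ne m j with rfl | hm
      · nlinarith
      · rw [flipMap_of_ne x hm]
    refine ⟨Or.inr ⟨i, hj.symm, l, ε, δ, hl, hδ, ?_, ?_,
      fun k hkj hki => ⟨?_, fun m hm => ?_⟩⟩, hdom'⟩
    · rwa [flipMap_of_ne x hj.symm]
    · rwa [cof_flipMap_left, cof_comm]
    · rw [flipMap_of_ne x hkj]
      refine (hex k hki hkj).1.trans_le ?_
      rw [cop, cop, norm_prod, norm_prod]
      exact Finset.prod_le_prod (fun _ _ => norm_nonneg _) fun m _ => hle m
    · refine ((hex k hki hkj).2 m hm).trans_le ?_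
      rw [cof, cof, norm_prod, norm_prod]
      exact Finset.prod_le_prod (fun _ _ => norm_nonneg _) fun m _ => hle m
  -- Here the flip leaves the geodesic: the old coordinate is less than half the product, so the new
  -- one is more than half of it.
  · have hgood : Good K (flipMap j x) j := by
      refine ⟨?_, fun k hk => ?_⟩
      · rw [cop_flipMap, flipMap_self]
        linarith [norm_sub_norm_le (cop x j) (x j), (hex j hj hjp).1]
      · rw [cof_flipMap_left]
        exact (hex j hj hjp).2 k hk
    refine ⟨Or.inl hgood, ?_⟩
    have h3 := hgood.dominates hj.symm
    rw [flipMap_of_ne x hj.symm] at h3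
    nlinarith [norm_nonneg (x i)]

theorem Tail.dominates (h : Tail K ρ x i) : ∃ j, 0 < ‖x j‖ ∧ ρ * ‖x j‖ ≤ ‖x i‖ := by
  obtain ⟨j, -, l, ε, δ, hl, -, hx, -, -⟩ := h
  refine ⟨j, ?_, ?_⟩
  · rcases (norm_nonneg (x j)).eq_or_lt with h0 | h0
    · rw [← h0, mul_zero] at hx
      exact absurd hx (norm_nonneg _).not_gt
    · exact h0
  · have h3 := norm_sub_norm_le (l * x j) (l * x j - x i)
    rw [sub_sub_cancel, norm_sub_rev (l * x j), norm_mul] at h3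
    nlinarith [norm_nonneg (x j)]

theorem Escape.pos (hρ : 1 < ρ) (h : Escape K ρ x i) : 0 < ‖x i‖ := by
  rcases h with h | h
  · linarith [h.1, norm_nonneg (cop x i)]
  · obtain ⟨j, hj, hji⟩ := h.dominates
    exact lt_of_lt_of_le (by positivity) hji

theorem Escape.flip (hK : 2 * ρ ≤ K) (hρ : 1 < ρ) (h : Escape K ρ x i) (hj : j ≠ i) :
    Escape K ρ (flipMap j x) j ∧ ρ * ‖x i‖ ≤ ‖flipMap j x j‖ := by
  rcases h with h | h
  · have hgood := h.flip (by linarith) hj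
    refine ⟨Or.inl hgood, ?_⟩
    have h3 := hgood.dominates hj.symm
    rw [flipMap_of_ne x hj.symm] at h3
    nlinarith [norm_nonneg (x i)]
  · exact h.flip hK hρ hj

theorem Escape.lt_norm_cof (hK : 2 ≤ K) (h : Escape K ρ x i) (hj : j ≠ i) (hk : k ≠ i)
    (hjk : j ≠ k) : K < ‖cof x j k‖ := by
  rcases h with h | ⟨p, -, l, ε, δ, -, -, -, -, hex⟩
  · exact h.lt_norm_cof hK hj hk hjk
  · rcases eq_or_ne j p with rfl | hjp
    · rw [cof_comm]
      exact (hex k hk hjk.symm).2 j hjk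
    · exact (hex j hj hjp).2 k hjk.symm

theorem continuous_cof (i j : Fin n) : Continuous fun x : Fin n → ℂ => cof x i j :=
  continuous_finsetProd _ fun k _ => continuous_apply k

theorem continuous_cop (i : Fin n) : Continuous fun x : Fin n → ℂ => cop x i :=
  continuous_finsetProd _ fun k _ => continuous_apply k

theorem continuous_flipMap (i : Fin n) : Continuous (flipMap (n := n) i) :=
  continuous_id.update i ((continuous_cop i).sub (continuous_apply i))

theorem isOpen_forall_ne_lt_norm_cof (K : ℝ) (i : Fin n) :
    IsOpen {x : Fin n → ℂ | ∀ j, j ≠ i → K < ‖cof x i j‖} := by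
  simp only [Set.ofPred_forall]
  exact isOpen_iInter_of_finite fun j => isOpen_iInter_of_finite fun _ =>
    isOpen_lt continuous_const (continuous_cof i j).norm

/-- Every condition on `x` is a strict inequality and `l`, `ε`, `δ` are merely existential. Keeping
`l` fixed while the product varies within `δ` makes the condition stable under perturbation. -/
theorem isOpen_setOf_tail (K ρ : ℝ) (i : Fin n) :
    IsOpen {x : Fin n → ℂ | Tail K ρ x i} := by
  simp only [Tail, Set.ofPred_exists, Set.ofPred_and, Set.ofPred_forall]
  refine isOpen_iUnion fun j => (isOpen_iInter_of_finite fun _ => isOpen_const).inter <| isOpen_iUnion fun l =>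
    isOpen_iUnion fun ε => isOpen_iUnion fun δ =>
    isOpen_const.inter (isOpen_const.inter (IsOpen.inter ?_ (IsOpen.inter ?_ ?_)))
  · exact isOpen_lt ((continuous_apply i).sub (continuous_const.mul (continuous_apply j))).norm
      (continuous_const.mul (continuous_apply j).norm)
  · exact isOpen_lt ((continuous_cof i j).sub continuous_const).norm continuous_const
  · refine isOpen_iInter_of_finite fun k => isOpen_iInter_of_finite fun _ =>
      isOpen_iInter_of_finite fun _ => IsOpen.inter ?_ ?_
    · exact isOpen_lt (continuous_const.mul (continuous_apply k).norm) (continuous_cop k).norm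
    · simpa only [Set.ofPred_forall] using isOpen_forall_ne_lt_norm_cof K k

theorem isOpen_setOf_escape (K ρ : ℝ) (i : Fin n) :
    IsOpen {x : Fin n → ℂ | Escape K ρ x i} := by
  simp only [Escape, Good, Set.ofPred_or, Set.ofPred_and]
  exact IsOpen.union ((isOpen_lt (continuous_cop i).norm
    (continuous_const.mul (continuous_apply i).norm)).inter (isOpen_forall_ne_lt_norm_cof K i))
    (isOpen_setOf_tail K ρ i)

end Escape

end MarkoffHurwitz

/-! ### Escape at one length implies growth and the Bowditch conditions -/

namespace MarkoffHurwitz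

/-- The closed interval `[-2, 2]` in the complex plane. -/
def cutInterval : Set ℂ := Complex.ofReal '' Set.Icc (-2 : ℝ) 2

theorem isClosed_cutInterval : IsClosed cutInterval :=
  (isCompact_Icc.image Complex.continuous_ofReal).isClosed

theorem notMem_cutInterval_of_lt {z : ℂ} (h : 2 < ‖z‖) : z ∉ cutInterval := by
  rintro ⟨t, ht, rfl⟩
  rw [Complex.norm_real, Real.norm_eq_abs] at h
  exact absurd (abs_le.mpr ht) h.not_ge

theorem continuous_pt {n : ℕ} (l : List (Fin n)) : Continuous fun a : Fin n → ℂ => pt a l := by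
  induction l with
  | nil => exact continuous_id
  | cons i l ih => exact (continuous_flipMap i).comp ih

/-- The alternating geodesic with labels `i`, `j` through a vertex. -/
def geod {n : ℕ} (g : Gam n) {i j : Fin n} (h : i ≠ j) : AltGeodesic n :=
  ⟨⟨{i, j}, Finset.card_pair h⟩, (labelGraph {i, j}).connectedComponentMk g⟩

theorem extHurwitz_geod {n : ℕ} (a : Fin n → ℂ) (l : List (Fin n)) {i j : Fin n} (h : i ≠ j) :
    extHurwitz a (geod (ev l) h) = cof (pt a l) i j := by
  rw [geod, extHurwitz_mk, vecHurwitz_ev, cof]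

theorem exists_geod_base {n : ℕ} (γ : AltGeodesic n) :
    ∃ (i j : Fin n) (h : i ≠ j), γ.1.1 = {i, j} ∧ γ = geod (ev (base γ)) h := by
  obtain ⟨i, j, h, hI⟩ := Finset.card_eq_two.mp γ.1.2
  refine ⟨i, j, h, hI, ?_⟩
  generalize hb : base γ = b
  have h1 := mk_base γ
  rw [hb] at h1
  obtain ⟨⟨I, hc⟩, c⟩ := γ
  subst hI
  exact h1

variable {n : ℕ} {a : Fin n → ℂ} {K ρ : ℝ} {N : ℕ}

/-- All reduced words of length `N + 1` lead to points which escape. -/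
def EscapesAt (K ρ : ℝ) (N : ℕ) (a : Fin n → ℂ) : Prop :=
  ∀ i l, Reduced (i :: l) → l.length = N → Escape K ρ (pt a (i :: l)) i

theorem EscapesAt.escape (hK : 2 * ρ ≤ K) (hρ : 1 < ρ) (h : EscapesAt K ρ N a) {i : Fin n}
    {l : List (Fin n)} (hr : Reduced (i :: l)) (hl : N ≤ l.length) :
    Escape K ρ (pt a (i :: l)) i := by
  induction l generalizing i with
  | nil => exact h i [] hr (by simpa using hl.antisymm')
  | cons j l ih =>
    rcases hl.eq_or_lt with hl | hl
    · exact h i _ hr hl.symm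
    · exact ((ih hr.tail (Nat.lt_succ_iff.mp hl)).flip hK hρ (List.isChain_cons_cons.mp hr).1).1

theorem EscapesAt.growth (hK : 2 * ρ ≤ K) (hρ : 1 < ρ) (h : EscapesAt K ρ N a) {d : ℝ}
    (hd : ∀ i l, Reduced (i :: l) → l.length = N → d ≤ ‖pt a (i :: l) i‖) {i : Fin n}
    {l : List (Fin n)} (hr : Reduced (i :: l)) (hl : N ≤ l.length) :
    ρ ^ (l.length - N) * d ≤ ‖pt a (i :: l) i‖ := by
  induction l generalizing i with
  | nil =>
    have hN : N = 0 := by simpa using hl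
    subst hN
    simpa using hd i [] hr rfl
  | cons j l ih =>
    rcases hl.eq_or_lt with hl | hl
    · simpa [← hl] using hd i _ hr hl.symm
    · have hl' : N ≤ l.length := Nat.lt_succ_iff.mp hl
      have h1 := ih hr.tail hl'
      have h2 := ((h.escape hK hρ hr.tail hl').flip hK hρ (List.isChain_cons_cons.mp hr).1).2
      rw [List.length_cons, Nat.sub_add_comm hl', pow_succ']
      calc ρ * ρ ^ (l.length - N) * d = ρ * (ρ ^ (l.length - N) * d) := by ring
        _ ≤ ρ * ‖pt a (j :: l) j‖ := by gcongr
        _ ≤ _ := h2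

theorem mem_bowditchDomain_of_escapesAt (hK : 2 * ρ ≤ K) (hρ : 1 < ρ) (h : EscapesAt K ρ N a)
    (hs : ∀ l : List (Fin n), l.length ≤ N → ∀ i j, i ≠ j → cof (pt a l) i j ∉ cutInterval) :
    a ∈ bowditchDomain n := by
  have key : ∀ γ : AltGeodesic n, N < (base γ).length → K < ‖extHurwitz a γ‖ := by
    intro γ hγ
    obtain ⟨i, j, hij, hI, hg⟩ := exists_geod_base γ
    have hr := base_reduced γ
    cases hb : base γ with
    | nil => simp [hb] at hγ
    | cons k l =>
      have hk := base_eq_cons hb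
      rw [hI] at hk
      simp only [Finset.mem_insert, Finset.mem_singleton, not_or] at hk
      rw [hb] at hr hγ
      rw [hg, hb, extHurwitz_geod]
      exact (h.escape hK hρ hr (Nat.lt_succ_iff.mp hγ)).lt_norm_cof (by linarith) (Ne.symm hk.1)
        (Ne.symm hk.2) hij
  refine ⟨fun γ => ?_, K, by linarith, ?_⟩
  · rcases lt_or_ge N (base γ).length with hγ | hγ
    · exact notMem_cutInterval_of_lt (lt_trans (by linarith) (key γ hγ))
    · obtain ⟨i, j, hij, hI, hg⟩ := exists_geod_base γ
      rw [hg, extHurwitz_geod]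
      exact hs _ hγ i j hij
  · refine Set.Finite.subset (((List.finite_length_le (Fin n) N).prod
      (Set.finite_univ (α := {I : Finset (Fin n) // I.card = 2}))).image
      fun p => (⟨p.2, (labelGraph p.2.1).connectedComponentMk (ev p.1)⟩ : AltGeodesic n)) ?_
    intro γ hγ
    refine ⟨(base γ, γ.1), ⟨?_, Set.mem_univ _⟩, (mk_base γ).symm⟩
    by_contra hlt
    exact absurd (key γ (not_le.mp hlt)) (not_lt.mpr hγ)

theorem bowditchDomain_nonempty (hn : 3 ≤ n) : (bowditchDomain n).Nonempty := by
  have hcof : ∀ i j : Fin n, i ≠ j → cof (fun _ => (4 : ℂ)) i j = 4 ^ (n - 2) := by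
    intro i j h
    rw [cof, Finset.prod_const, Finset.card_compl, Finset.card_pair h, Fintype.card_fin]
  have hge : (4 : ℝ) ≤ 4 ^ (n - 2) := by
    calc (4 : ℝ) = 4 ^ 1 := by norm_num
      _ ≤ 4 ^ (n - 2) := pow_le_pow_right₀ (by norm_num) (by omega)
  have hex : ∀ i : Fin n, ∃ j, j ≠ i := fun i => by
    have : Nontrivial (Fin n) := Fin.nontrivial_iff_two_le.mpr (by omega)
    exact exists_ne i
  -- With `N = 0` only the words of length one have to escape, and each of them is `Good`.
  refine ⟨fun _ => 4, mem_bowditchDomain_of_escapesAt (K := 3) (ρ := 3 / 2) (N := 0)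
    (by norm_num) (by norm_num) ?_ ?_⟩
  · intro i l _ hl
    obtain rfl := List.length_eq_zero_iff.mp hl
    refine Or.inl ⟨?_, fun j hj => ?_⟩
    · obtain ⟨j, hj⟩ := hex i
      rw [pt, cop_flipMap, flipMap_self, pt, cop_eq _ hj, hcof i j hj.symm]
      have e : ((4 : ℂ) ^ (n - 2) * 4 - 4) = ((4 ^ (n - 2) * 4 - 4 : ℝ) : ℂ) := by push_cast; rfl
      have e' : ((4 : ℂ) ^ (n - 2) * 4) = ((4 ^ (n - 2) * 4 : ℝ) : ℂ) := by push_cast; rfl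
      rw [e, e', Complex.norm_real, Complex.norm_real, Real.norm_eq_abs, Real.norm_eq_abs,
        abs_of_nonneg (by linarith), abs_of_nonneg (by linarith)]
      linarith
    · rw [pt, cof_flipMap_left, pt, hcof i j hj.symm, norm_pow]
      norm_num
      linarith
  · intro l hl i j hij
    obtain rfl := List.length_eq_zero_iff.mp (Nat.le_zero.mp hl)
    refine notMem_cutInterval_of_lt ?_
    rw [pt, hcof i j hij, norm_pow]
    norm_num
    linarith

end MarkoffHurwitz

/-! ### The linear recurrence along an alternating geodesic -/

namespace MarkoffHurwitz

section Recurrence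

/-- The roots of `X ^ 2 - c * X + 1` are mutually inverse; if they had modulus one, `c` would be
twice their common real part, hence in `[-2, 2]`. -/
theorem exists_add_inv_eq {c : ℂ} (hc : c ∉ cutInterval) : ∃ l : ℂ, 1 < ‖l‖ ∧ l + l⁻¹ = c := by
  obtain ⟨s, hs⟩ := IsAlgClosed.exists_pow_nat_eq (c ^ 2 - 4) (n := 2) (by norm_num)
  set l := (c + s) / 2 with hl
  have hmul : l * (c - l) = 1 := by
    rw [hl]; linear_combination -hs / 4
  have hl0 : l ≠ 0 := left_ne_zero_of_mul_eq_one hmul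
  have hinv : l⁻¹ = c - l := inv_eq_of_mul_eq_one_right hmul
  rcases lt_trichotomy ‖l‖ 1 with h | h | h
  · refine ⟨l⁻¹, ?_, by rw [inv_inv, hinv]; ring⟩
    rw [norm_inv]
    exact (one_lt_inv₀ (norm_pos_iff.mpr hl0)).mpr h
  · refine absurd ?_ hc
    have h1 : l⁻¹ = (starRingEnd ℂ) l := Complex.inv_eq_conj h
    have h2 : c = ((2 * l.re : ℝ) : ℂ) := by
      rw [← Complex.add_conj, ← h1, hinv]; ring
    have h3 := abs_le.mp ((Complex.abs_re_le_norm l).trans h.le)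
    exact ⟨2 * l.re, ⟨by linarith [h3.1], by linarith [h3.2]⟩, h2.symm⟩
  · exact ⟨l, h, by rw [hinv]; ring⟩

/-- The solution of `y (m + 2) = c * y (m + 1) - y m` with given initial values. -/
def recSeq (c y₀ y₁ : ℂ) : ℕ → ℂ
  | 0 => y₀
  | 1 => y₁
  | m + 2 => c * recSeq c y₀ y₁ (m + 1) - recSeq c y₀ y₁ m

variable {l c y₀ y₁ : ℂ}

theorem recSeq_succ_sub_inv_mul (hl : l ≠ 0) (hc : l + l⁻¹ = c) (m : ℕ) :
    recSeq c y₀ y₁ (m + 1) - l⁻¹ * recSeq c y₀ y₁ m = l ^ m * (y₁ - l⁻¹ * y₀) := by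
  induction m with
  | zero => simp [recSeq]
  | succ m ih =>
    rw [pow_succ', mul_assoc, ← ih, recSeq, ← hc]
    field_simp
    ring

theorem recSeq_succ_sub_mul (hl : l ≠ 0) (hc : l + l⁻¹ = c) (m : ℕ) :
    recSeq c y₀ y₁ (m + 1) - l * recSeq c y₀ y₁ m = l⁻¹ ^ m * (y₁ - l * y₀) := by
  have := recSeq_succ_sub_inv_mul (l := l⁻¹) (c := c) (y₀ := y₀) (y₁ := y₁) (inv_ne_zero hl)
    (by rw [inv_inv, ← hc, add_comm]) m
  rwa [inv_inv] at this

theorem tendsto_recSeq_zero (hl : 1 < ‖l‖) (hc : l + l⁻¹ = c) (h : y₁ - l⁻¹ * y₀ = 0) :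
    Filter.Tendsto (recSeq c y₀ y₁) Filter.atTop (nhds 0) := by
  have hl0 : l ≠ 0 := norm_pos_iff.mp (one_pos.trans hl)
  have h1 : ∀ m, recSeq c y₀ y₁ m = l⁻¹ ^ m * y₀ := by
    intro m
    induction m with
    | zero => simp [recSeq]
    | succ m ih =>
      have := recSeq_succ_sub_inv_mul (y₀ := y₀) (y₁ := y₁) hl0 hc m
      rw [h, mul_zero, sub_eq_zero] at this
      rw [this, ih]
      ring
  have h2 : Filter.Tendsto (fun m : ℕ => l⁻¹ ^ m * y₀) Filter.atTop (nhds (0 * y₀)) :=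
    (tendsto_pow_atTop_nhds_zero_of_norm_lt_one (by
      rw [norm_inv]; exact inv_lt_one_of_one_lt₀ hl)).mul_const _
  rw [zero_mul] at h2
  exact h2.congr fun m => (h1 m).symm

theorem norm_recSeq_succ_sub_le (hl : 1 < ‖l‖) (hc : l + l⁻¹ = c) (m : ℕ) :
    ‖recSeq c y₀ y₁ (m + 1) - l * recSeq c y₀ y₁ m‖ ≤ ‖y₁ - l * y₀‖ := by
  rw [recSeq_succ_sub_mul (norm_pos_iff.mp (one_pos.trans hl)) hc, norm_mul, norm_pow, norm_inv]
  exact mul_le_of_le_one_left (norm_nonneg _)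
    (pow_le_one₀ (by positivity) (inv_le_one_of_one_le₀ hl.le))

/-- Up to the factor `l - l⁻¹`, the quantity `y₁ - l⁻¹ * y₀` is the coefficient of `l ^ m` in the
solution. -/
theorem tendsto_norm_recSeq_atTop (hl : 1 < ‖l‖) (hc : l + l⁻¹ = c) (h : y₁ - l⁻¹ * y₀ ≠ 0) :
    Filter.Tendsto (fun m => ‖recSeq c y₀ y₁ m‖) Filter.atTop Filter.atTop := by
  have hl0 : l ≠ 0 := norm_pos_iff.mp (one_pos.trans hl)
  have hd : 0 < ‖l‖ + 1 := by positivity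
  have hpow : Filter.Tendsto (fun m : ℕ => ‖l‖ ^ m * ‖y₁ - l⁻¹ * y₀‖) Filter.atTop
      Filter.atTop :=
    (tendsto_pow_atTop_atTop_of_one_lt hl).atTop_mul_const (norm_pos_iff.mpr h)
  have hbound : ∀ m, (‖l‖ ^ m * ‖y₁ - l⁻¹ * y₀‖ - ‖y₁ - l * y₀‖) / (‖l‖ + 1) ≤
      ‖recSeq c y₀ y₁ m‖ := by
    intro m
    rw [div_le_iff₀ hd]
    have h1 := recSeq_succ_sub_inv_mul (y₀ := y₀) (y₁ := y₁) hl0 hc m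
    have h2 := norm_recSeq_succ_sub_le (y₀ := y₀) (y₁ := y₁) hl hc m
    have h3 : l ^ m * (y₁ - l⁻¹ * y₀) = (recSeq c y₀ y₁ (m + 1) - l * recSeq c y₀ y₁ m) +
        (l - l⁻¹) * recSeq c y₀ y₁ m := by rw [← h1]; ring
    have h4 : ‖l‖ ^ m * ‖y₁ - l⁻¹ * y₀‖ ≤ ‖y₁ - l * y₀‖ +
        ‖l - l⁻¹‖ * ‖recSeq c y₀ y₁ m‖ := by
      rw [← norm_pow, ← norm_mul, h3, ← norm_mul]
      exact (norm_add_le _ _).trans (by gcongr)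
    have h5 : ‖l - l⁻¹‖ ≤ ‖l‖ + 1 := by
      refine (norm_sub_le _ _).trans ?_
      rw [norm_inv]
      gcongr
      exact inv_le_one_of_one_le₀ hl.le
    nlinarith [norm_nonneg (recSeq c y₀ y₁ m)]
  refine Filter.tendsto_atTop_mono hbound ?_
  exact (Filter.tendsto_atTop_add_const_right _ _ hpow).atTop_div_const hd

end Recurrence

variable {n : ℕ} {a : Fin n → ℂ} {i j k : Fin n} {u : List (Fin n)}

/-- The letters of an alternating word. -/
def letter (i j : Fin n) (m : ℕ) : Fin n := if Even m then i else j

theorem letter_add_two (i j : Fin n) (m : ℕ) : letter i j (m + 2) = letter i j m := by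
  simp [letter, Nat.even_add]

theorem letter_pair (i j : Fin n) (m : ℕ) :
    ({letter i j m, letter i j (m + 1)} : Finset (Fin n)) = {i, j} := by
  by_cases h : Even m <;> simp [letter, h, Nat.even_add_one, Finset.pair_comm]

theorem letter_succ_ne (hij : i ≠ j) (m : ℕ) : letter i j (m + 1) ≠ letter i j m := by
  by_cases h : Even m <;> simp [letter, h, Nat.even_add_one, hij, hij.symm]

theorem letter_ne (hi : k ≠ i) (hj : k ≠ j) (m : ℕ) : k ≠ letter i j m := by
  by_cases h : Even m <;> simp [letter, h, hi, hj]

theorem eq_letter_succ (hk : k = i ∨ k = j) {m : ℕ} (h : k ≠ letter i j m) :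
    k = letter i j (m + 1) := by
  by_cases hm : Even m <;> simp [letter, hm, Nat.even_add_one] at h ⊢ <;> tauto

/-- The word `u` followed by `m` alternating letters, the first of which is `i`. -/
def alt (i j : Fin n) (u : List (Fin n)) : ℕ → List (Fin n)
  | 0 => u
  | m + 1 => letter i j m :: alt i j u m

theorem length_alt (i j : Fin n) (u : List (Fin n)) (m : ℕ) :
    (alt i j u m).length = m + u.length := by
  induction m with
  | zero => simp [alt]
  | succ m ih => rw [alt, List.length_cons, ih]; ring

theorem reduced_alt (hij : i ≠ j) (hu : Reduced (i :: u)) (m : ℕ) :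
    Reduced (alt i j u (m + 1)) := by
  induction m with
  | zero => simpa [alt, letter] using hu
  | succ m ih => exact List.isChain_cons_cons.mpr ⟨letter_succ_ne hij m, ih⟩

theorem eq_alt_of_dropWhile {w : List (Fin n)} (hw : Reduced w) :
    ∃ m, w = alt i j (w.dropWhile (· ∈ ({i, j} : Finset (Fin n)))) m ∨
      w = alt j i (w.dropWhile (· ∈ ({i, j} : Finset (Fin n)))) m := by
  induction w with
  | nil => exact ⟨0, Or.inl rfl⟩
  | cons k t ih =>
    by_cases hk : k ∈ ({i, j} : Finset (Fin n))
    · rw [List.dropWhile_cons_of_pos (by simpa using hk)]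
      generalize t.dropWhile _ = u at ih ⊢
      have hk' : k = i ∨ k = j := by simpa using hk
      obtain ⟨m, h⟩ := ih hw.tail
      cases m with
      | zero =>
        have ht : t = u := by simpa [alt] using h
        refine ⟨1, hk'.imp ?_ ?_⟩ <;> rintro rfl <;> simp [alt, letter, ht]
      | succ m =>
        refine ⟨m + 2, h.imp ?_ ?_⟩ <;> rintro rfl
        · rw [alt, eq_letter_succ hk' (List.isChain_cons_cons.mp hw).1]; rfl
        · rw [alt, eq_letter_succ hk'.symm (List.isChain_cons_cons.mp hw).1]; rfl
    · rw [List.dropWhile_cons_of_neg (by simpa using hk)]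
      exact ⟨0, Or.inl rfl⟩

theorem pt_alt_of_ne (hki : k ≠ i) (hkj : k ≠ j) (m : ℕ) :
    pt a (alt i j u m) k = pt a u k := by
  induction m with
  | zero => rfl
  | succ m ih => rw [alt, pt, flipMap_of_ne _ (letter_ne hki hkj m), ih]

theorem cof_pt_alt (i j : Fin n) (m : ℕ) : cof (pt a (alt i j u m)) i j = cof (pt a u) i j :=
  Finset.prod_congr rfl fun k hk => by
    simp only [Finset.mem_compl, Finset.mem_insert, Finset.mem_singleton, not_or] at hk
    exact pt_alt_of_ne hk.1 hk.2 m

theorem cof_letter (x : Fin n → ℂ) (i j : Fin n) (m : ℕ) :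
    cof x (letter i j m) (letter i j (m + 1)) = cof x i j := by
  rw [cof, letter_pair, cof]

theorem pt_alt_letter (hij : i ≠ j) (m : ℕ) :
    pt a (alt i j u m) (letter i j m) =
        recSeq (cof (pt a u) i j) (pt a u i) (pt a u j) m ∧
      pt a (alt i j u m) (letter i j (m + 1)) =
        recSeq (cof (pt a u) i j) (pt a u i) (pt a u j) (m + 1) := by
  induction m with
  | zero => simp [alt, letter, recSeq]
  | succ m ih =>
    refine ⟨?_, ?_⟩
    · rw [alt, pt, flipMap_of_ne _ (letter_succ_ne hij m), ih.2]
    · rw [letter_add_two, alt, pt, flipMap_self, cop_eq _ (letter_succ_ne hij m), cof_letter,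
        cof_pt_alt, ih.1, ih.2, recSeq]

theorem base_geod {w : List (Fin n)} (hw : Reduced w) (h : i ≠ j) :
    base (geod (ev w) h) = w.dropWhile (· ∈ ({i, j} : Finset (Fin n))) :=
  base_mk _ hw

/-- The coordinates do not decay along an alternating geodesic, as otherwise infinitely many
alternating geodesics that meet it would be small. -/
theorem sub_inv_mul_ne_zero (hn : 3 ≤ n) {K : ℝ} (hK : 0 < K)
    (hF : {γ : AltGeodesic n | ‖extHurwitz a γ‖ ≤ K}.Finite) (hij : i ≠ j)
    (hu : Reduced (i :: u)) {l : ℂ} (hl : 1 < ‖l‖) (hc : l + l⁻¹ = cof (pt a u) i j) :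
    pt a u j - l⁻¹ * pt a u i ≠ 0 := by
  intro h0
  obtain ⟨k, hki, hkj⟩ := Fin.exists_ne_and_ne_of_two_lt i j hn
  set D := ∏ q ∈ ({i, j, k} : Finset (Fin n))ᶜ, pt a u q with hD
  have hval : ∀ m, cof (pt a (alt i j u (m + 1))) k (letter i j (m + 1)) =
      recSeq (cof (pt a u) i j) (pt a u i) (pt a u j) (m + 2) * D := by
    intro m
    rw [cof_eq _ (letter_ne hki hkj m) (letter_succ_ne hij m), ← letter_add_two,
      (pt_alt_letter hij (m + 1)).2, letter_add_two]
    congr 1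
    have e : ({k, letter i j (m + 1), letter i j m} : Finset (Fin n)) = {i, j, k} := by
      rw [Finset.pair_comm, letter_pair]
      ext; simp; tauto
    rw [e]
    refine Finset.prod_congr rfl fun q hq => ?_
    simp only [Finset.mem_compl, Finset.mem_insert, Finset.mem_singleton, not_or] at hq
    exact pt_alt_of_ne hq.1 hq.2.1 _
  -- The transversal geodesics with labels `k` and the current letter have the value `y (m + 2) *
  -- D`, which tends to zero.
  have hlim := (((tendsto_recSeq_zero hl hc h0).mul_const D).norm).eventually_lt_const
    (u := K) (by simpa using hK)
  obtain ⟨M, hM⟩ := Filter.eventually_atTop.mp hlim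
  refine Set.infinite_of_injective_forall_mem (f := fun m : ℕ =>
    geod (ev (alt i j u (M + m + 1))) (letter_ne hki hkj (M + m + 1))) ?_ ?_ hF
  -- These geodesics are distinct, as their bases have different lengths.
  · intro m m' hmm
    have hb : ∀ m, base (geod (ev (alt i j u (m + 1))) (letter_ne hki hkj (m + 1))) =
        alt i j u (m + 1) := by
      intro m
      rw [base_geod (reduced_alt hij hu m), alt, List.dropWhile_cons_of_neg]
      simp [(letter_ne hki hkj m).symm, (letter_succ_ne hij m).symm]
    have h2 := congrArg (fun γ => (base γ).length) hmm
    simp only [hb, length_alt] at h2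
    omega
  · intro m
    change ‖_‖ ≤ K
    rw [extHurwitz_geod, hval]
    exact (hM _ (by omega)).le

end MarkoffHurwitz

/-! ### Every point of the domain escapes at some length -/

namespace MarkoffHurwitz

variable {n : ℕ} {a : Fin n → ℂ} {i j k : Fin n} {u : List (Fin n)} {K ρ : ℝ}

theorem zero_mem_cutInterval : (0 : ℂ) ∈ cutInterval := ⟨0, by norm_num, by simp⟩

/-- If two coordinates are replaced by large ones, then all the products which contain one of
them are large. -/
theorem exists_lt_norm_prod (x : Fin n → ℂ) (hx : ∀ k, k ≠ i → k ≠ j → x k ≠ 0) (C : ℝ) :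
    ∃ R : ℝ, ∀ z : Fin n → ℂ, (∀ k, k ≠ i → k ≠ j → z k = x k) → R ≤ ‖z i‖ → R ≤ ‖z j‖ →
      ∀ s : Finset (Fin n), i ∈ s ∨ j ∈ s → C < ‖∏ k ∈ s, z k‖ := by
  obtain ⟨s₀, -, hs₀⟩ := (Finset.univ : Finset (Finset (Fin n))).exists_min_image
    (fun s => ‖∏ k ∈ s \ {i, j}, x k‖) ⟨∅, Finset.mem_univ _⟩
  set d := ‖∏ k ∈ s₀ \ {i, j}, x k‖ with hd
  have hd0 : 0 < d := norm_pos_iff.mpr (Finset.prod_ne_zero_iff.mpr fun k hk => by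
    simp only [Finset.mem_sdiff, Finset.mem_insert, Finset.mem_singleton, not_or] at hk
    exact hx k hk.2.1 hk.2.2)
  refine ⟨max 1 ((|C| + 1) / d), fun z hz hi hj s hs => ?_⟩
  have h1 : ∏ k ∈ s, z k = (∏ k ∈ s \ {i, j}, x k) * ∏ k ∈ s ∩ {i, j}, z k := by
    rw [← Finset.prod_inter_mul_prod_sdiff s {i, j}, mul_comm]
    congr 1
    refine Finset.prod_congr rfl fun k hk => ?_
    simp only [Finset.mem_sdiff, Finset.mem_insert, Finset.mem_singleton, not_or] at hk
    exact hz k hk.2.1 hk.2.2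
  have hbig : ∀ k ∈ ({i, j} : Finset (Fin n)), max 1 ((|C| + 1) / d) ≤ ‖z k‖ := by
    intro k hk
    simp only [Finset.mem_insert, Finset.mem_singleton] at hk
    rcases hk with rfl | rfl <;> assumption
  obtain ⟨p, hps, hp⟩ : ∃ p ∈ s, p ∈ ({i, j} : Finset (Fin n)) := by
    rcases hs with h | h
    · exact ⟨i, h, by simp⟩
    · exact ⟨j, h, by simp⟩
  have h2 : (|C| + 1) / d ≤ ‖∏ k ∈ s ∩ {i, j}, z k‖ := by
    rw [← Finset.mul_prod_erase _ _ (Finset.mem_inter.mpr ⟨hps, hp⟩), norm_mul, norm_prod]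
    refine ((le_max_right 1 _).trans (hbig p hp)).trans
      (le_mul_of_one_le_right (norm_nonneg _) (Finset.one_le_prod fun k hk => ?_))
    exact (le_max_left _ _).trans
      (hbig k (Finset.mem_inter.mp (Finset.mem_of_mem_erase hk)).2)
  rw [h1, norm_mul]
  calc C < |C| + 1 := by linarith [le_abs_self C]
    _ = d * ((|C| + 1) / d) := by field_simp
    _ ≤ _ := mul_le_mul (hs₀ s (Finset.mem_univ _)) h2 (by positivity) (norm_nonneg _)

theorem exists_tail_alt (hn : 3 ≤ n) (hK : 0 < K) (hρ : 1 < ρ)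
    (hF : {γ : AltGeodesic n | ‖extHurwitz a γ‖ ≤ K}.Finite) (hij : i ≠ j)
    (hu : Reduced (i :: u)) {l : ℂ} (hl : ρ < ‖l‖) (hc : l + l⁻¹ = cof (pt a u) i j)
    (hc0 : cof (pt a u) i j ≠ 0) :
    ∃ m, Tail K ρ (pt a (alt i j u (m + 1))) (letter i j m) := by
  have hl1 : 1 < ‖l‖ := hρ.trans hl
  set x := pt a u with hx
  set y := recSeq (cof x i j) (x i) (x j) with hy
  have hx0 : ∀ k, k ≠ i → k ≠ j → x k ≠ 0 := fun k hki hkj =>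
    Finset.prod_ne_zero_iff.mp hc0 k (by simp [hki, hkj])
  -- This threshold serves both transversal conditions of `Tail`: products above `2 * ‖x k‖` and
  -- above `K`.
  obtain ⟨R, hR⟩ := exists_lt_norm_prod x hx0 (K + 2 * ∑ k, ‖x k‖)
  have hlim : Filter.Tendsto (fun m => ‖y m‖) Filter.atTop Filter.atTop :=
    tendsto_norm_recSeq_atTop hl1 hc (sub_inv_mul_ne_zero hn hK hF hij hu hl1 hc)
  set ε := ‖l‖ - ρ with hε
  have hε0 : 0 < ε := sub_pos.mpr hl
  obtain ⟨m, hm⟩ := Filter.eventually_atTop.mp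
    (hlim.eventually_gt_atTop (max R (‖x j - l * x i‖ / ε)))
  have hm1 := max_lt_iff.mp (hm (m + 1) (by omega))
  have hm2 := max_lt_iff.mp (hm (m + 2) (by omega))
  set z := pt a (alt i j u (m + 1)) with hz
  have hz1 : z (letter i j (m + 1)) = y (m + 1) := (pt_alt_letter hij (m + 1)).1
  have hz2 : z (letter i j m) = y (m + 2) := by
    rw [← letter_add_two]; exact (pt_alt_letter hij (m + 1)).2
  have hzk : ∀ k, k ≠ i → k ≠ j → z k = x k := fun k hki hkj => pt_alt_of_ne hki hkj _
  have hzbig : ∀ k ∈ ({i, j} : Finset (Fin n)), R ≤ ‖z k‖ := by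
    rw [← letter_pair i j m]
    intro k hk
    simp only [Finset.mem_insert, Finset.mem_singleton] at hk
    rcases hk with rfl | rfl
    · rw [hz2]; exact hm2.1.le
    · rw [hz1]; exact hm1.1.le
  have hprod := hR z hzk (hzbig i (by simp)) (hzbig j (by simp))
  suffices h : Tail K ρ z (letter i j m) from ⟨m, h⟩
  -- The product equals `l + l⁻¹` exactly here, so any positive `δ` would do; this is the largest
  -- one that `Tail` admits.
  refine ⟨letter i j (m + 1), letter_succ_ne hij m, l, ε, ε * (1 - 1 / ρ ^ 2), by linarith,
    (by ring_nf; rfl), ?_, ?_, fun k hk hk' => ?_⟩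
  · rw [hz1, hz2]
    refine (norm_recSeq_succ_sub_le hl1 hc (m + 1)).trans_lt ?_
    exact (div_lt_iff₀' hε0).mp hm1.2
  · rw [cof_letter, hz, cof_pt_alt, ← hx, ← hc, sub_self, norm_zero]
    have : 1 / ρ ^ 2 < 1 := by
      rw [div_lt_one (by positivity)]
      exact one_lt_pow₀ hρ (by norm_num)
    exact mul_pos hε0 (by linarith)
  · have hkij : k ∉ ({i, j} : Finset (Fin n)) := by
      rw [← letter_pair i j m]; simp [hk, hk']
    simp only [Finset.mem_insert, Finset.mem_singleton, not_or] at hkij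
    have hsum : ‖x k‖ ≤ ∑ k, ‖x k‖ :=
      Finset.single_le_sum (f := fun k => ‖x k‖) (fun _ _ => norm_nonneg _) (Finset.mem_univ k)
    refine ⟨?_, fun q hq => ?_⟩
    · rw [hzk k hkij.1 hkij.2]
      have := hprod (Finset.univ.erase k) (Or.inl (by simp [Ne.symm hkij.1]))
      rw [cop]
      linarith
    · have := hprod ({k, q} : Finset (Fin n))ᶜ (by
        by_cases h : i = q
        · right; simp [Ne.symm hkij.2, ← h, hij.symm]
        · left; simp [Ne.symm hkij.1, h])
      rw [cof]
      linarith [norm_nonneg (x k)]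

theorem exists_escape_alt (hn : 3 ≤ n) (hK : 2 * ρ ≤ K) (hρ : 1 < ρ)
    (hF : {γ : AltGeodesic n | ‖extHurwitz a γ‖ ≤ K}.Finite) (hij : i ≠ j)
    (hu : Reduced (i :: u)) {l : ℂ} (hl : ρ < ‖l‖) (hc : l + l⁻¹ = cof (pt a u) i j)
    (hc0 : cof (pt a u) i j ≠ 0) :
    ∃ M, ∀ m, M ≤ m → Escape K ρ (pt a (alt i j u (m + 1))) (letter i j m) := by
  obtain ⟨M, hM⟩ := exists_tail_alt hn (by linarith) hρ hF hij hu hl hc hc0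
  refine ⟨M, fun m hm => ?_⟩
  induction m, hm using Nat.le_induction with
  | base => exact Or.inr hM
  | succ m hm ih => exact (ih.flip hK hρ (letter_succ_ne hij m)).1

/-- A geodesic has two ends, according to which label is used first at its base; each end eventually
escapes. -/
theorem exists_escape_of_geod_eq (hn : 3 ≤ n) (hK : 2 * ρ ≤ K) (hρ : 1 < ρ)
    (hF : {γ : AltGeodesic n | ‖extHurwitz a γ‖ ≤ K}.Finite) (γ : AltGeodesic n)
    (hγ : extHurwitz a γ ∉ cutInterval) {l : ℂ} (hl : ρ < ‖l‖)
    (hc : l + l⁻¹ = extHurwitz a γ) :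
    ∃ N, ∀ i w, Reduced (i :: w) → N ≤ w.length → ∀ j (h : i ≠ j),
      geod (ev (i :: w)) h = γ → Escape K ρ (pt a (i :: w)) i := by
  obtain ⟨p, q, hpq, hI, hg⟩ := exists_geod_base γ
  have hur := base_reduced γ
  have hhead : ∀ r, r ∈ ({p, q} : Finset (Fin n)) → Reduced (r :: base γ) := by
    intro r hr
    cases hb : base γ with
    | nil => exact List.isChain_singleton r
    | cons k t =>
      have hk := base_eq_cons hb
      rw [hI] at hk
      rw [hb] at hur
      exact List.isChain_cons_cons.mpr ⟨fun e => hk (e ▸ hr), hur⟩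
  have hval : extHurwitz a γ = cof (pt a (base γ)) p q := by
    conv_lhs => rw [hg]
    exact extHurwitz_geod a _ hpq
  have h0 : cof (pt a (base γ)) p q ≠ 0 := by
    rw [← hval]; rintro e; exact hγ (e ▸ zero_mem_cutInterval)
  obtain ⟨M₁, hM₁⟩ := exists_escape_alt hn hK hρ hF hpq (hhead p (by simp)) hl
    (hc.trans hval) h0
  obtain ⟨M₂, hM₂⟩ := exists_escape_alt hn hK hρ hF hpq.symm (hhead q (by simp)) hl
    (hc.trans (hval.trans (cof_comm _ _ _))) (by rwa [cof_comm])
  refine ⟨(base γ).length + M₁ + M₂, fun i w hr hw j hij hgeod => ?_⟩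
  have hset : ({i, j} : Finset (Fin n)) = {p, q} := by
    rw [← hI, ← hgeod]; rfl
  have hbase : base γ = (i :: w).dropWhile (· ∈ ({p, q} : Finset (Fin n))) := by
    rw [← hset, ← base_geod hr hij, hgeod]
  obtain ⟨m, hm⟩ := eq_alt_of_dropWhile (i := p) (j := q) hr
  rw [← hbase] at hm
  have hlen : w.length + 1 = m + (base γ).length := by
    rcases hm with h | h <;> simpa [length_alt] using congrArg List.length h
  obtain ⟨m, rfl⟩ : ∃ m', m = m' + 1 := ⟨m - 1, by omega⟩
  rcases hm with h | h
  · have hi : i = letter p q m := by simpa [alt] using congrArg List.head? h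
    rw [h, hi]
    exact hM₁ m (by omega)
  · have hi : i = letter q p m := by simpa [alt] using congrArg List.head? h
    rw [h, hi]
    exact hM₂ m (by omega)

/-- One step back along a path of points with large products, but small last coordinates. -/
theorem descend (hK : 2 ≤ K) {x : Fin n → ℂ} (hij : i ≠ j)
    (hc : ∀ k, k ≠ i → K < ‖cof (flipMap i x) i k‖)
    (hs : 2 * ‖flipMap i x i‖ ≤ ‖cop (flipMap i x) i‖) :
    (∀ k, k ≠ j → K < ‖cof x j k‖) ∧ 2 * ‖x j‖ ≤ ‖cop x j‖ ∧
      K / 2 * ‖cop (flipMap i x) i‖ ≤ ‖cop x j‖ := by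
  simp only [cof_flipMap_left, cop_flipMap, flipMap_self] at hc hs ⊢
  have h1 : ‖cop x i‖ ≤ 2 * ‖x i‖ := by
    have := norm_sub_norm_le (cop x i) (cop x i - x i)
    rw [sub_sub_cancel] at this
    linarith
  have h2 : ‖cop x i‖ = ‖cof x i j‖ * ‖x j‖ := by rw [cop_eq x hij.symm, norm_mul]
  have h3 : ‖cop x j‖ = ‖cof x i j‖ * ‖x i‖ := by rw [cop_eq x hij, norm_mul, cof_comm]
  have hcj := hc j hij.symm
  have h4 : ‖x j‖ ≤ ‖x i‖ := by nlinarith [norm_nonneg (x j)]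
  refine ⟨fun k hk => ?_, ?_, ?_⟩
  · rcases eq_or_ne k i with rfl | hki
    · rwa [cof_comm]
    · have h5 := hc k hki
      rw [cof_eq x hij hk, norm_mul] at h5
      rw [cof_eq x hij.symm hki, norm_mul]
      have e : ({j, k, i} : Finset (Fin n)) = {i, k, j} := by ext; simp; tauto
      rw [e]
      exact h5.trans_le (by gcongr)
  · rw [h3]; nlinarith [norm_nonneg (x i)]
  · rw [h3]; nlinarith [norm_nonneg (x i)]

/-- If all other coordinates were below one, the products `cof x i k` could not exceed `K ≥ 1`;
otherwise a coordinate of modulus at least one is the missing factor. -/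
theorem lt_norm_cop (hn : 3 ≤ n) (hK : 1 ≤ K) {x : Fin n → ℂ}
    (hc : ∀ k, k ≠ i → K < ‖cof x i k‖) : K < ‖cop x i‖ := by
  by_cases h : ∃ k, k ≠ i ∧ 1 ≤ ‖x k‖
  · obtain ⟨k, hk, h1⟩ := h
    rw [cop_eq x hk, norm_mul]
    nlinarith [hc k hk]
  · push Not at h
    obtain ⟨k, hk, -⟩ := Fin.exists_ne_and_ne_of_two_lt i i hn
    refine absurd (hc k hk) (not_lt.mpr (le_trans ?_ hK))
    rw [cof, norm_prod]
    refine Finset.prod_le_one (fun _ _ => norm_nonneg _) fun q hq => (h q ?_).le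
    simp only [Finset.mem_compl, Finset.mem_insert, Finset.mem_singleton, not_or] at hq
    exact hq.1

/-- Iterating `descend` to the root gains a factor `K / 2` per letter, while the right-hand side is
independent of the word. -/
theorem pow_mul_norm_cop_le (hK : 2 ≤ K) {w : List (Fin n)} (hr : Reduced (i :: w))
    (hc : ∀ k, k ≠ i → K < ‖cof (pt a (i :: w)) i k‖)
    (hs : 2 * ‖pt a (i :: w) i‖ ≤ ‖cop (pt a (i :: w)) i‖) :
    (K / 2) ^ w.length * ‖cop (pt a (i :: w)) i‖ ≤ ∑ k, ‖cop a k‖ := by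
  induction w generalizing i with
  | nil =>
    simpa [pt, cop_flipMap] using Finset.single_le_sum (f := fun k => ‖cop a k‖)
      (fun _ _ => norm_nonneg _) (Finset.mem_univ i)
  | cons j w ih =>
    obtain ⟨h1, h2, h3⟩ := descend hK (List.isChain_cons_cons.mp hr).1 hc hs
    refine le_trans ?_ (ih hr.tail h1 h2)
    rw [List.length_cons, pow_succ, mul_assoc]
    gcongr
    exact h3

theorem exists_escapesAt (hn : 3 ≤ n) (ha : a ∈ bowditchDomain n) :
    ∃ K ρ N, 2 * ρ ≤ K ∧ 1 < ρ ∧ EscapesAt K ρ N a := by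
  obtain ⟨hcut, K, hK, hF⟩ := ha
  choose l hl hc using fun γ => exists_add_inv_eq (hcut γ)
  -- One growth rate serves all small geodesics because condition (ii) makes them finite in number.
  obtain ⟨ρ, hρ1, hρK, hρ⟩ : ∃ ρ : ℝ, 1 < ρ ∧ ρ < K / 2 ∧
      ∀ γ ∈ {γ : AltGeodesic n | ‖extHurwitz a γ‖ ≤ K}, ρ < ‖l γ‖ := by
    have h1 : ∀ᶠ ρ in nhdsWithin (1 : ℝ) (Set.Ioi 1), 1 < ρ := self_mem_nhdsWithin
    have h2 : ∀ b : ℝ, 1 < b → ∀ᶠ ρ in nhdsWithin (1 : ℝ) (Set.Ioi 1), ρ < b := fun b hb =>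
      mem_nhdsWithin_of_mem_nhds (Iio_mem_nhds hb)
    exact (h1.and ((h2 (K / 2) (by linarith)).and
      ((Filter.eventually_all_finite hF).mpr fun γ _ => h2 _ (hl γ)))).exists
  have hK' : 2 * ρ ≤ K := by linarith
  obtain ⟨N₁, hN₁⟩ : ∃ N₁, ∀ γ ∈ {γ : AltGeodesic n | ‖extHurwitz a γ‖ ≤ K},
      ∀ i w, Reduced (i :: w) → N₁ ≤ w.length → ∀ j (h : i ≠ j),
        geod (ev (i :: w)) h = γ → Escape K ρ (pt a (i :: w)) i := by
    have h1 := (Filter.eventually_all_finite (l := Filter.atTop) hF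
      (p := fun γ N => ∀ i w, Reduced (i :: w) → N ≤ w.length → ∀ j (h : i ≠ j),
        geod (ev (i :: w)) h = γ → Escape K ρ (pt a (i :: w)) i)).mpr fun γ hγ => by
      obtain ⟨N, hN⟩ := exists_escape_of_geod_eq hn hK' hρ1 hF γ (hcut γ) (hρ γ hγ) (hc γ)
      filter_upwards [Filter.eventually_ge_atTop N] with N' hN' i w hr hw
      exact hN i w hr (hN'.trans hw)
    exact h1.exists
  obtain ⟨N₂, hN₂⟩ := pow_unbounded_of_one_lt (∑ k, ‖cop a k‖)
    (show 1 < K / 2 by linarith)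
  refine ⟨K, ρ, max N₁ N₂, hK', hρ1, fun i w hr hw => ?_⟩
  by_cases hsmall : ∃ j, j ≠ i ∧ ‖cof (pt a (i :: w)) i j‖ ≤ K
  · obtain ⟨j, hj, hle⟩ := hsmall
    refine hN₁ (geod (ev (i :: w)) hj.symm) ?_ i w hr (hw ▸ le_max_left _ _) j hj.symm rfl
    change ‖_‖ ≤ K
    rwa [extHurwitz_geod]
  · push Not at hsmall
    refine Or.inl ⟨?_, hsmall⟩
    by_contra hnot
    have h1 := pow_mul_norm_cop_le hK.le hr hsmall (not_lt.mp hnot)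
    have h2 := lt_norm_cop hn (by linarith) hsmall
    have h3 : (K / 2) ^ N₂ ≤ (K / 2) ^ w.length :=
      pow_le_pow_right₀ (by linarith) (hw ▸ le_max_right _ _)
    have h4 : 0 < (K / 2) ^ N₂ := by positivity
    nlinarith

end MarkoffHurwitz

/-! ### Openness, proper discontinuity and invariance -/

namespace MarkoffHurwitz

variable {n : ℕ} {a : Fin n → ℂ}

/-- Finitely many words carry the whole condition, each through an open set of points, so the same
`ρ`, `d` and `N` work near `a`. -/
theorem exists_nhds_growth (hn : 3 ≤ n) (ha : a ∈ bowditchDomain n) :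
    ∃ (ρ d : ℝ) (N : ℕ), 1 < ρ ∧ 0 < d ∧ ∀ᶠ b in nhds a, b ∈ bowditchDomain n ∧
      ∀ i w, Reduced (i :: w) → N ≤ w.length → ρ ^ (w.length - N) * d ≤ ‖pt b (i :: w) i‖ := by
  obtain ⟨K, ρ, N, hK, hρ, h⟩ := exists_escapesAt hn ha
  have hfin : {w : List (Fin n) | w.length = N}.Finite := List.finite_length_eq (Fin n) N
  obtain ⟨d, hd0, hd⟩ : ∃ d : ℝ, 0 < d ∧ ∀ i, ∀ w ∈ {w : List (Fin n) | w.length = N},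
      Reduced (i :: w) → d < ‖pt a (i :: w) i‖ := by
    have h1 : ∀ᶠ d in nhdsWithin (0 : ℝ) (Set.Ioi 0), 0 < d := self_mem_nhdsWithin
    refine (h1.and (Filter.eventually_all.mpr fun i =>
      (Filter.eventually_all_finite hfin).mpr fun w hw => ?_)).exists
    by_cases hr : Reduced (i :: w)
    · filter_upwards [mem_nhdsWithin_of_mem_nhds (Iio_mem_nhds ((h i w hr hw).pos hρ))]
        with d hd _ using hd
    · exact Filter.Eventually.of_forall fun _ h => absurd h hr
  refine ⟨ρ, d, N, hρ, hd0, ?_⟩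
  have e1 : ∀ᶠ b in nhds a, ∀ i, ∀ w ∈ {w : List (Fin n) | w.length = N},
      Reduced (i :: w) → Escape K ρ (pt b (i :: w)) i ∧ d < ‖pt b (i :: w) i‖ := by
    refine Filter.eventually_all.mpr fun i =>
      (Filter.eventually_all_finite hfin).mpr fun w hw => ?_
    by_cases hr : Reduced (i :: w)
    · have h1 := (continuous_pt (i :: w)).continuousAt.eventually
        ((isOpen_setOf_escape K ρ i).mem_nhds (h i w hr hw))
      have h2 := (((continuous_apply i).comp (continuous_pt (i :: w))).norm.continuousAt
        (x := a)).eventually (Ioi_mem_nhds (hd i w hw hr))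
      filter_upwards [h1, h2] with b hb1 hb2 _ using ⟨hb1, hb2⟩
    · exact Filter.Eventually.of_forall fun _ h => absurd h hr
  have e2 : ∀ᶠ b in nhds a, ∀ w ∈ {w : List (Fin n) | w.length ≤ N}, ∀ i j, i ≠ j →
      cof (pt b w) i j ∉ cutInterval := by
    refine (Filter.eventually_all_finite (List.finite_length_le (Fin n) N)).mpr fun w _ =>
      Filter.eventually_all.mpr fun i => Filter.eventually_all.mpr fun j =>
      Filter.eventually_all.mpr fun hij => ?_
    refine ((continuous_cof i j).comp (continuous_pt w)).continuousAt.eventually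
      (isClosed_cutInterval.isOpen_compl.mem_nhds ?_)
    have := ha.1 (geod (ev w) hij)
    rwa [extHurwitz_geod] at this
  filter_upwards [e1, e2] with b hb1 hb2
  have hesc : EscapesAt K ρ N b := fun i w hr hw => (hb1 i w hw hr).1
  exact ⟨mem_bowditchDomain_of_escapesAt hK hρ hesc hb2, fun i w hr hw =>
    hesc.growth hK hρ (fun i w hr hw => (hb1 i w hw hr).2.le) hr hw⟩

theorem isOpen_bowditchDomain (hn : 3 ≤ n) : IsOpen (bowditchDomain n) := by
  refine isOpen_iff_mem_nhds.mpr fun a ha => ?_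
  obtain ⟨_, _, _, -, -, h⟩ := exists_nhds_growth hn ha
  exact h.mono fun b hb => hb.1

theorem finite_setOf_norm_vecHurwitz_le (hn : 3 ≤ n) {C : Set (Fin n → ℂ)}
    (hC : C ⊆ bowditchDomain n) (hcomp : IsCompact C) (R : ℝ) :
    {g : Gam n | ∃ b ∈ C, ‖vecHurwitz b g‖ ≤ R}.Finite := by
  refine hcomp.induction_on (p := fun S => {g : Gam n | ∃ b ∈ S, ‖vecHurwitz b g‖ ≤ R}.Finite)
    (by simp) (fun S T hST hT => hT.subset fun g ⟨b, hb, hg⟩ => ⟨b, hST hb, hg⟩)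
    (fun S T hS hT => (hS.union hT).subset ?_) fun a ha => ?_
  · rintro g ⟨b, hb | hb, hg⟩
    · exact Or.inl ⟨b, hb, hg⟩
    · exact Or.inr ⟨b, hb, hg⟩
  · obtain ⟨ρ, d, N, hρ, hd, h⟩ := exists_nhds_growth hn (hC ha)
    refine ⟨_, mem_nhdsWithin_of_mem_nhds h, ?_⟩
    obtain ⟨M, hM⟩ := pow_unbounded_of_one_lt (R / d) hρ
    refine ((List.finite_length_le (Fin n) (N + M)).image ev).subset ?_
    rintro g ⟨b, ⟨-, hb⟩, hg⟩
    refine ⟨nf g, ?_, ev_nf g⟩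
    change (nf g).length ≤ N + M
    by_contra hlt
    rw [← ev_nf g, vecHurwitz_ev] at hg
    have hr := nf_reduced g
    cases hw : nf g with
    | nil => simp [hw] at hlt
    | cons i w =>
      rw [hw] at hr hg hlt
      have hlen : N + M ≤ w.length := by simpa [Nat.lt_succ_iff] using hlt
      have h1 := hb i w hr (by omega)
      have h2 : ρ ^ M ≤ ρ ^ (w.length - N) := pow_le_pow_right₀ hρ.le (by omega)
      have h3 := (div_lt_iff₀ hd).mp hM
      have h4 := norm_le_pi_norm (pt b (i :: w)) i
      nlinarith

theorem finite_setOf_inter_nonempty (hn : 3 ≤ n) {C : Set (Fin n → ℂ)}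
    (hC : C ⊆ bowditchDomain n) (hcomp : IsCompact C) :
    {g : Gam n | ((fun x : Fin n → ℂ => g • x) '' C ∩ C).Nonempty}.Finite := by
  obtain ⟨R, hR⟩ := hcomp.isBounded.exists_norm_le
  refine ((finite_setOf_norm_vecHurwitz_le hn hC hcomp R).image (·⁻¹)).subset ?_
  rintro g ⟨_, ⟨c, hc, rfl⟩, hgc⟩
  exact ⟨g⁻¹, ⟨c, hc, by simpa [vecHurwitz] using hR _ hgc⟩, inv_inv g⟩

/-- Left translation by `h` is an endomorphism of the Cayley graph which preserves the labels. -/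
def translateHom (h : Gam n) (I : Finset (Fin n)) :
    labelGraph (n := n) I →g labelGraph (n := n) I where
  toFun g := h * g
  map_rel' := by
    rintro x y ⟨hne, i, hi, e⟩
    exact ⟨fun e => hne (mul_left_cancel e), i, hi, by rw [e, mul_assoc]⟩

/-- Left translation by `h` on the alternating geodesics. -/
def translate (h : Gam n) (γ : AltGeodesic n) : AltGeodesic n :=
  ⟨γ.1, γ.2.map (translateHom h γ.1.1)⟩

theorem translate_injective (h : Gam n) : Function.Injective (translate h) := by
  refine Function.LeftInverse.injective (g := translate h⁻¹) ?_
  rintro ⟨I, c⟩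
  induction c using SimpleGraph.ConnectedComponent.ind with
  | h g =>
    exact congrArg (fun v => (⟨I, (labelGraph I.1).connectedComponentMk v⟩ : AltGeodesic n))
      (inv_mul_cancel_left h g)

theorem extHurwitz_smul (h : Gam n) (a : Fin n → ℂ) (γ : AltGeodesic n) :
    extHurwitz (h • a) γ = extHurwitz a (translate h⁻¹ γ) := by
  obtain ⟨I, c⟩ := γ
  induction c using SimpleGraph.ConnectedComponent.ind with
  | h g =>
    simp only [translate, translateHom, SimpleGraph.ConnectedComponent.map_mk, extHurwitz_mk]
    refine Finset.prod_congr rfl fun k _ => congrFun ?_ k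
    simp [vecHurwitz, mul_smul]

theorem smul_mem_bowditchDomain (h : Gam n) (ha : a ∈ bowditchDomain n) :
    h • a ∈ bowditchDomain n := by
  obtain ⟨hcut, K, hK, hF⟩ := ha
  refine ⟨fun γ => ?_, K, hK, ?_⟩
  · rw [extHurwitz_smul]
    exact hcut _
  · simp only [extHurwitz_smul]
    exact hF.preimage (translate_injective h⁻¹).injOn

theorem image_smul_bowditchDomain (h : Gam n) :
    (fun x : Fin n → ℂ => h • x) '' bowditchDomain n = bowditchDomain n := by
  refine Set.Subset.antisymm ?_ fun a ha => ⟨h⁻¹ • a, smul_mem_bowditchDomain h⁻¹ ha, ?_⟩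
  · rintro _ ⟨a, ha, rfl⟩
    exact smul_mem_bowditchDomain h ha
  · exact smul_inv_smul h a

end MarkoffHurwitz

/-! ### The origin is not in the closure -/

namespace MarkoffHurwitz

section Recurrence

variable {l c y₀ y₁ : ℂ} {κ θ : ℝ}

/-- For small `κ`, `l` is close to `±i`, so the cross terms of the two squares nearly cancel. What
remains is about `2 * (‖P‖ ^ 2 + ‖Q‖ ^ 2)`, which is about `4 * ‖P * Q‖` as `P` and `Q` have nearly
equal moduli. -/
theorem norm_sq_add_norm_sq_le {P Q : ℂ} (hl : 1 < ‖l‖) (hκ : ‖l + l⁻¹‖ ≤ κ) (hκ1 : κ ≤ 1)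
    (hQP : ‖Q‖ ≤ ‖P‖) (hPQ : ‖P‖ ≤ ‖l‖ ^ 2 * ‖Q‖) :
    ‖P + Q‖ ^ 2 + ‖P * l + Q * l⁻¹‖ ^ 2 ≤ (1 + 10 * κ) * ‖P * Q * (4 - (l + l⁻¹) ^ 2)‖ := by
  have hl0 : l ≠ 0 := norm_pos_iff.mp (one_pos.trans hl)
  have hκ0 : 0 ≤ κ := (norm_nonneg _).trans hκ
  have hinv : ‖l‖⁻¹ ≤ 1 := inv_le_one_of_one_le₀ hl.le
  have hL : ‖l‖ ≤ 1 + κ := by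
    have h1 := norm_sub_norm_le l (-l⁻¹)
    rw [sub_neg_eq_add, norm_neg, norm_inv] at h1
    linarith
  have hL2 : ‖l‖ ^ 2 ≤ 1 + 3 * κ := by nlinarith [norm_nonneg l]
  have hre : |l.re| ≤ κ := by
    have h1 : (l + l⁻¹).re = l.re * (1 + (Complex.normSq l)⁻¹) := by
      rw [Complex.add_re, Complex.inv_re]; ring
    have h2 := (Complex.abs_re_le_norm (l + l⁻¹)).trans hκ
    have h3 : 0 ≤ (Complex.normSq l)⁻¹ := inv_nonneg.mpr (Complex.normSq_nonneg l)
    rw [h1, abs_mul, abs_of_nonneg (by linarith : 0 ≤ 1 + (Complex.normSq l)⁻¹)] at h2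
    nlinarith [abs_nonneg l.re]
  have hcross : ‖P + Q‖ ^ 2 + ‖P * l + Q * l⁻¹‖ ^ 2 ≤
      ‖P‖ ^ 2 * (1 + ‖l‖ ^ 2) + 2 * ‖Q‖ ^ 2 + 4 * κ * (‖P‖ * ‖Q‖) := by
    have hc : 1 + l * (starRingEnd ℂ) l⁻¹ =
        ((2 * l.re : ℝ) : ℂ) * ((starRingEnd ℂ) l)⁻¹ := by
      have h0 : (starRingEnd ℂ) l ≠ 0 := (map_ne_zero _).mpr hl0
      rw [← Complex.add_conj, map_inv₀]
      field_simp
      ring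
    have h1 : ‖1 + l * (starRingEnd ℂ) l⁻¹‖ ≤ 2 * κ := by
      rw [hc, norm_mul, norm_inv, Complex.norm_conj, Complex.norm_real, Real.norm_eq_abs,
        abs_mul, abs_two]
      nlinarith [abs_nonneg l.re, inv_nonneg.mpr (norm_nonneg l)]
    have h2 : (P * (starRingEnd ℂ) Q).re + (P * l * (starRingEnd ℂ) (Q * l⁻¹)).re ≤
        ‖P‖ * ‖Q‖ * (2 * κ) := by
      have e : P * (starRingEnd ℂ) Q + P * l * (starRingEnd ℂ) (Q * l⁻¹) =
          P * (starRingEnd ℂ) Q * (1 + l * (starRingEnd ℂ) l⁻¹) := by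
        rw [map_mul]; ring
      rw [← Complex.add_re, e]
      refine (Complex.re_le_norm _).trans ?_
      rw [norm_mul, norm_mul, Complex.norm_conj]
      gcongr
    have h3 : ‖P * l‖ ^ 2 = ‖P‖ ^ 2 * ‖l‖ ^ 2 := by rw [norm_mul, mul_pow]
    have h4 : ‖Q * l⁻¹‖ ^ 2 ≤ ‖Q‖ ^ 2 := by
      rw [norm_mul, norm_inv]
      gcongr
      exact mul_le_of_le_one_right (norm_nonneg _) hinv
    rw [← Complex.normSq_eq_norm_sq, ← Complex.normSq_eq_norm_sq, Complex.normSq_add,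
      Complex.normSq_add, Complex.normSq_eq_norm_sq, Complex.normSq_eq_norm_sq,
      Complex.normSq_eq_norm_sq, Complex.normSq_eq_norm_sq, h3]
    linarith
  set p := ‖P‖ * ‖Q‖ with hp
  have hp0 : 0 ≤ p := by positivity
  have hP2 : ‖P‖ ^ 2 ≤ (1 + 3 * κ) * p := by
    have : ‖P‖ * ‖P‖ ≤ ‖P‖ * (‖l‖ ^ 2 * ‖Q‖) := by gcongr
    have h2 : ‖l‖ ^ 2 * p ≤ (1 + 3 * κ) * p := by gcongr
    nlinarith
  have hQ2 : ‖Q‖ ^ 2 ≤ p := by nlinarith [norm_nonneg Q]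
  have hq : (4 - κ) * p ≤ ‖P * Q * (4 - (l + l⁻¹) ^ 2)‖ := by
    rw [norm_mul, norm_mul, ← hp, mul_comm]
    gcongr
    have h1 := norm_sub_norm_le (4 : ℂ) ((l + l⁻¹) ^ 2)
    rw [norm_pow] at h1
    norm_num at h1
    nlinarith [norm_nonneg (l + l⁻¹)]
  have h1 : ‖P‖ ^ 2 * (1 + ‖l‖ ^ 2) ≤ (1 + 3 * κ) * p * (2 + 3 * κ) := by
    refine mul_le_mul hP2 (by linarith) (by positivity) (by positivity)
  have h2 : (1 + 3 * κ) * p * (2 + 3 * κ) + 2 * p + 4 * κ * p ≤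
      (1 + 10 * κ) * ((4 - κ) * p) := by
    have : (1 + 3 * κ) * (2 + 3 * κ) + 2 + 4 * κ ≤ (1 + 10 * κ) * (4 - κ) := by nlinarith
    nlinarith
  have h3 := mul_le_mul_of_nonneg_left hq (by linarith : 0 ≤ 1 + 10 * κ)
  linarith

theorem exists_pow_between {A B L : ℝ} (hA : 0 < A) (hAB : A ≤ B) (hL : 1 < L) :
    ∃ m : ℕ, B ≤ A * L ^ m ∧ A * L ^ m ≤ L * B := by
  have hex : ∃ m : ℕ, B ≤ A * L ^ m := by
    obtain ⟨m, hm⟩ := pow_unbounded_of_one_lt (B / A) hL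
    exact ⟨m, by rw [mul_comm]; exact ((div_lt_iff₀ hA).mp hm).le⟩
  classical
  refine ⟨Nat.find hex, Nat.find_spec hex, ?_⟩
  rcases h : Nat.find hex with _ | m
  · nlinarith
  · have h1 := not_le.mp (Nat.find_min hex (m := m) (by omega))
    rw [pow_succ]
    nlinarith

/-- The solution is `A * l ^ m + B * l⁻¹ ^ m` and the invariant form equals `A * B * (4 - c ^ 2)`.
As `‖A‖ ≤ ‖B‖`, some `m ≥ 0` balances the two terms; `θ` is needed only if `A = 0`, when the
sequence decays. -/
theorem exists_recSeq_small (hl : 1 < ‖l‖) (hc : l + l⁻¹ = c) (hκ : ‖c‖ ≤ κ) (hκ1 : κ ≤ 1)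
    (hθ : 0 < θ) (h : ‖y₁ - l⁻¹ * y₀‖ ≤ ‖l * y₀ - y₁‖) :
    ∃ m, ‖recSeq c y₀ y₁ m‖ ^ 2 + ‖recSeq c y₀ y₁ (m + 1)‖ ^ 2 ≤
      (1 + 10 * κ) * ‖y₀ ^ 2 + y₁ ^ 2 - c * y₀ * y₁‖ + θ := by
  have hl0 : l ≠ 0 := norm_pos_iff.mp (one_pos.trans hl)
  have hκ0 : 0 ≤ κ := (norm_nonneg _).trans hκ
  rcases eq_or_ne (y₁ - l⁻¹ * y₀) 0 with h0 | h0
  · have h1 := tendsto_recSeq_zero hl hc h0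
    have h2 := (h1.norm.pow 2).add (((Filter.tendsto_add_atTop_iff_nat 1).mpr h1).norm.pow 2)
    obtain ⟨m, hm⟩ := (h2.eventually_lt_const (u := θ) (by simpa using hθ)).exists
    exact ⟨m, hm.le.trans (le_add_of_nonneg_left (by positivity))⟩
  · have hd : l - l⁻¹ ≠ 0 := by
      intro e
      have h1 : ‖l‖ = ‖l‖⁻¹ := by rw [← norm_inv]; exact congrArg _ (sub_eq_zero.mp e)
      have h2 := inv_lt_one_of_one_lt₀ hl
      linarith
    set A := (y₁ - l⁻¹ * y₀) / (l - l⁻¹) with hA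
    set B := (l * y₀ - y₁) / (l - l⁻¹) with hB
    have hAB : ‖A‖ ≤ ‖B‖ := by
      rw [hA, hB, norm_div, norm_div]
      gcongr
    have hAd : A * (l - l⁻¹) = y₁ - l⁻¹ * y₀ := div_mul_cancel₀ _ hd
    have hBd : B * (l - l⁻¹) = l * y₀ - y₁ := div_mul_cancel₀ _ hd
    have hy₀ : y₀ = A + B := mul_left_cancel₀ hd (by linear_combination -hAd - hBd)
    have hy₁ : y₁ = A * l + B * l⁻¹ :=
      mul_left_cancel₀ hd (by linear_combination -l * hAd - l⁻¹ * hBd)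
    have hy : ∀ m, recSeq c y₀ y₁ m = A * l ^ m + B * l⁻¹ ^ m := by
      intro m
      have h1 := recSeq_succ_sub_inv_mul (y₀ := y₀) (y₁ := y₁) hl0 hc m
      have h2 := recSeq_succ_sub_mul (y₀ := y₀) (y₁ := y₁) hl0 hc m
      have h3 : (l - l⁻¹) * recSeq c y₀ y₁ m =
          l ^ m * (y₁ - l⁻¹ * y₀) + l⁻¹ ^ m * (l * y₀ - y₁) := by
        linear_combination h1 - h2
      exact mul_left_cancel₀ hd (by linear_combination h3 - l ^ m * hAd - l⁻¹ ^ m * hBd)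
    have hq : y₀ ^ 2 + y₁ ^ 2 - c * y₀ * y₁ = A * B * (4 - (l + l⁻¹) ^ 2) := by
      rw [hy₀, hy₁, ← hc]; field_simp; ring
    obtain ⟨m, hm1, hm2⟩ := exists_pow_between
      (norm_pos_iff.mpr (div_ne_zero h0 hd)) hAB (one_lt_pow₀ hl (n := 2) (by norm_num))
    have hpos : 0 < ‖l‖ ^ m := by positivity
    have hinv : ‖l⁻¹ ^ m‖ * ‖l‖ ^ m = 1 := by
      rw [norm_pow, norm_inv, ← mul_pow, inv_mul_cancel₀ (by positivity), one_pow]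
    refine ⟨m, ?_⟩
    have hPQ : A * l ^ m * (B * l⁻¹ ^ m) = A * B := by
      have : l ^ m * l⁻¹ ^ m = 1 := by rw [← mul_pow, mul_inv_cancel₀ hl0, one_pow]
      linear_combination A * B * this
    have key := norm_sq_add_norm_sq_le (P := A * l ^ m) (Q := B * l⁻¹ ^ m) hl (hc ▸ hκ) hκ1 ?_ ?_
    · rw [hPQ] at key
      rw [hy, hy, hq, pow_succ l, pow_succ l⁻¹, ← mul_assoc, ← mul_assoc]
      linarith
    · refine le_of_mul_le_mul_right ?_ hpos
      rw [norm_mul, norm_mul, mul_assoc, hinv, mul_one, norm_pow]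
      calc ‖B‖ ≤ _ := hm1
        _ = _ := by ring
    · refine le_of_mul_le_mul_right ?_ hpos
      rw [norm_mul, norm_mul, mul_assoc, mul_assoc, mul_assoc, hinv, mul_one, norm_pow]
      calc ‖A‖ * (‖l‖ ^ m * ‖l‖ ^ m) = ‖A‖ * (‖l‖ ^ 2) ^ m := by ring
        _ ≤ _ := hm2

end Recurrence

variable {n : ℕ} {a x : Fin n → ℂ} {i j k : Fin n} {u : List (Fin n)} {r : ℝ}

/-- On an alternating geodesic with a small value there is a vertex at which the moving coordinates
are nearly as small as the invariant quadratic form allows. -/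
theorem exists_alt_small {κ θ : ℝ} (hij : i ≠ j) (hc : cof (pt a u) i j ∉ cutInterval)
    (hκ : ‖cof (pt a u) i j‖ ≤ κ) (hκ1 : κ ≤ 1) (hθ : 0 < θ) :
    ∃ m, ∃ w, (w = alt i j u m ∨ w = alt j i u m) ∧
      ‖pt a w i‖ ^ 2 + ‖pt a w j‖ ^ 2 ≤ (1 + 10 * κ) * ‖pt a u i ^ 2 + pt a u j ^ 2 -
        cof (pt a u) i j * pt a u i * pt a u j‖ + θ := by
  have hpair : ∀ (p q : Fin n), p ≠ q → ∀ m, ‖pt a (alt p q u m) p‖ ^ 2 +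
      ‖pt a (alt p q u m) q‖ ^ 2 =
        ‖recSeq (cof (pt a u) p q) (pt a u p) (pt a u q) m‖ ^ 2 +
        ‖recSeq (cof (pt a u) p q) (pt a u p) (pt a u q) (m + 1)‖ ^ 2 := by
    intro p q hpq m
    rw [← (pt_alt_letter hpq m).1, ← (pt_alt_letter hpq m).2, ← Finset.sum_pair hpq (f := fun k =>
      ‖pt a (alt p q u m) k‖ ^ 2), ← letter_pair p q m,
      Finset.sum_pair (letter_succ_ne hpq m).symm]
  obtain ⟨l, hl, hlc⟩ := exists_add_inv_eq hc
  have hl0 : l ≠ 0 := norm_pos_iff.mp (one_pos.trans hl)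
  rcases le_total ‖pt a u j - l⁻¹ * pt a u i‖ ‖l * pt a u i - pt a u j‖ with h | h
  · obtain ⟨m, hm⟩ := exists_recSeq_small hl hlc hκ hκ1 hθ h
    exact ⟨m, _, Or.inl rfl, by rwa [hpair i j hij]⟩
  -- The balanced vertex lies in the other direction, where the roles of `i` and `j` are exchanged.
  · have h' : ‖pt a u i - l⁻¹ * pt a u j‖ ≤ ‖l * pt a u j - pt a u i‖ := by
      have e1 : pt a u i - l⁻¹ * pt a u j = l⁻¹ * (l * pt a u i - pt a u j) := by field_simp
      have e2 : l * pt a u j - pt a u i = l * (pt a u j - l⁻¹ * pt a u i) := by field_simp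
      rw [e1, e2, norm_mul, norm_mul, norm_inv]
      refine mul_le_mul (le_trans ?_ hl.le) h (norm_nonneg _) (norm_nonneg _)
      exact inv_le_one_of_one_le₀ hl.le
    obtain ⟨m, hm⟩ := exists_recSeq_small hl hlc hκ hκ1 hθ h'
    refine ⟨m, _, Or.inr rfl, ?_⟩
    rw [add_comm, hpair j i hij.symm, cof_comm]
    convert hm using 4
    ring

/-- The Markoff-Hurwitz polynomial. -/
noncomputable def hurwitz (x : Fin n → ℂ) : ℂ := ∑ k, x k ^ 2 - ∏ k, x k

/-- The square of the Euclidean norm. -/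
noncomputable def energy (x : Fin n → ℂ) : ℝ := ∑ k, ‖x k‖ ^ 2

theorem hurwitz_eq (x : Fin n → ℂ) (i : Fin n) :
    hurwitz x = x i ^ 2 - x i * cop x i + ∑ k ∈ Finset.univ.erase i, x k ^ 2 := by
  rw [hurwitz, ← Finset.add_sum_erase _ _ (Finset.mem_univ i),
    ← Finset.mul_prod_erase _ _ (Finset.mem_univ i), cop]
  ring

theorem hurwitz_flipMap (x : Fin n → ℂ) (i : Fin n) : hurwitz (flipMap i x) = hurwitz x := by
  rw [hurwitz_eq _ i, hurwitz_eq x i, cop_flipMap, flipMap_self]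
  have : ∑ k ∈ Finset.univ.erase i, flipMap i x k ^ 2 = ∑ k ∈ Finset.univ.erase i, x k ^ 2 :=
    Finset.sum_congr rfl fun k hk => by rw [flipMap_of_ne x (Finset.ne_of_mem_erase hk)]
  rw [this]
  ring

theorem hurwitz_pt (a : Fin n → ℂ) (u : List (Fin n)) : hurwitz (pt a u) = hurwitz a := by
  induction u with
  | nil => rfl
  | cons i u ih => rw [pt, hurwitz_flipMap, ih]

theorem norm_le_of_energy_le (hr : 0 ≤ r) (h : energy x ≤ r ^ 2) (k : Fin n) : ‖x k‖ ≤ r := by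
  have h1 : ‖x k‖ ^ 2 ≤ energy x :=
    Finset.single_le_sum (f := fun k => ‖x k‖ ^ 2) (fun _ _ => by positivity) (Finset.mem_univ k)
  exact (sq_le_sq₀ (norm_nonneg _) hr).mp (h1.trans h)

theorem norm_cof_le (hn : 3 ≤ n) (hr : r ≤ 1) (h : ∀ k, ‖x k‖ ≤ r) (i j : Fin n) :
    ‖cof x i j‖ ≤ r := by
  obtain ⟨k, hki, hkj⟩ := Fin.exists_ne_and_ne_of_two_lt i j hn
  rw [cof_eq x hki.symm hkj.symm, norm_mul, norm_prod]
  exact (mul_le_of_le_one_right (norm_nonneg _) (Finset.prod_le_one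
    (fun _ _ => norm_nonneg _) fun q _ => (h q).trans hr)).trans (h k)

theorem norm_cop_le (hn : 3 ≤ n) (hr : r ≤ 1) (h : ∀ k, ‖x k‖ ≤ r) (i : Fin n) :
    ‖cop x i‖ ≤ r ^ 2 := by
  obtain ⟨k, hki, -⟩ := Fin.exists_ne_and_ne_of_two_lt i i hn
  rw [cop_eq x hki, norm_mul, sq]
  exact mul_le_mul (norm_cof_le hn hr h i k) (h k) (norm_nonneg _)
    ((norm_nonneg _).trans (h k))

theorem energy_flipMap_le (hn : 3 ≤ n) (hr : r ≤ 1) (h : ∀ k, ‖x k‖ ≤ r) (i : Fin n) :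
    energy (flipMap i x) ≤ energy x + 3 * r ^ 3 := by
  have hr0 : 0 ≤ r := (norm_nonneg _).trans (h i)
  rw [energy, energy, ← Finset.add_sum_erase _ _ (Finset.mem_univ i),
    ← Finset.add_sum_erase Finset.univ (fun k => ‖x k‖ ^ 2) (Finset.mem_univ i)]
  have h1 : ∑ k ∈ Finset.univ.erase i, ‖flipMap i x k‖ ^ 2 =
      ∑ k ∈ Finset.univ.erase i, ‖x k‖ ^ 2 :=
    Finset.sum_congr rfl fun k hk => by rw [flipMap_of_ne x (Finset.ne_of_mem_erase hk)]
  have h2 : ‖flipMap i x i‖ ≤ r ^ 2 + ‖x i‖ := by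
    rw [flipMap_self]
    exact (norm_sub_le _ _).trans (by gcongr; exact norm_cop_le hn hr h i)
  have h3 : ‖flipMap i x i‖ ^ 2 ≤ (r ^ 2 + ‖x i‖) ^ 2 := by gcongr
  have h4 : r ^ 2 * ‖x i‖ ≤ r ^ 2 * r := by gcongr; exact h i
  have h5 : r ^ 3 * r ≤ r ^ 3 * 1 := by gcongr
  rw [h1]
  nlinarith

/-- If the squares of the coordinates nearly cancel, then two of them partly cancel. -/
theorem exists_norm_sq_add_sq_le (hn : 3 ≤ n) (hr : 0 < r) (hrn : 1000 * (n : ℝ) ^ 2 * r ≤ 1)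
    (hH : ‖hurwitz x‖ ≤ r ^ 3) (h : energy x ≤ r ^ 2) (h' : r ^ 2 / 2 < energy x) :
    ∃ i j, i ≠ j ∧
      ‖x i ^ 2 + x j ^ 2‖ ≤ ‖x i‖ ^ 2 + ‖x j‖ ^ 2 - r ^ 2 / (8 * (n : ℝ) ^ 2) := by
  have hn0 : (3 : ℝ) ≤ n := by exact_mod_cast hn
  have hr1 : r ≤ 1 := by nlinarith
  have hxr := norm_le_of_energy_le hr.le h
  have : NeZero n := ⟨by omega⟩
  obtain ⟨p, -, hp⟩ := Finset.univ.exists_max_image (fun k => ‖x k‖ ^ 2)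
    (Finset.univ_nonempty (α := Fin n))
  set M := ‖x p‖ ^ 2 with hM
  have hME : energy x ≤ n * M := by
    refine (Finset.sum_le_card_nsmul _ _ M hp).trans ?_
    simp
  have hMr : r ^ 2 ≤ 2 * n * M := by nlinarith
  have hM0 : 0 < M := by
    by_contra hneg
    nlinarith [not_lt.mp hneg, sq_pos_of_pos hr]
  -- The sum of squares is `hurwitz x` plus the product of all coordinates, hence of order `r ^ 3`,
  -- whereas `M` has order at least `r ^ 2 / n`.
  have hsum : ‖∑ k, x k ^ 2‖ ≤ M / 2 := by
    have h1 : ∑ k, x k ^ 2 = hurwitz x + x p * cop x p := by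
      rw [hurwitz_eq x p, ← Finset.add_sum_erase _ _ (Finset.mem_univ p)]; ring
    have h2 : ‖x p‖ * ‖cop x p‖ ≤ r * r ^ 2 := by
      gcongr
      · exact hxr p
      · exact norm_cop_le hn hr1 hxr p
    have h3 : ‖∑ k, x k ^ 2‖ ≤ 2 * r ^ 3 := by
      rw [h1]
      refine (norm_add_le _ _).trans ?_
      rw [norm_mul]
      linarith
    have h4 : 4 * r * r ^ 2 ≤ 4 * r * (2 * n * M) := by gcongr
    have h5 : (8 * n * r) * M ≤ 1 * M := by
      gcongr
      nlinarith
    linarith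
  set f : Fin n → ℝ := fun k => (x k ^ 2 * (starRingEnd ℂ) (x p ^ 2)).re with hf
  have hfp : f p = M ^ 2 := by
    simp only [hf, Complex.mul_conj, Complex.ofReal_re, Complex.normSq_eq_norm_sq, norm_pow, hM]
  have hfsum : ∑ k, f k ≤ M / 2 * M := by
    simp only [hf]
    rw [← Complex.re_sum, ← Finset.sum_mul]
    refine (Complex.re_le_norm _).trans ?_
    rw [norm_mul, Complex.norm_conj, norm_pow (x p)]
    gcongr
  rw [← Finset.add_sum_erase _ _ (Finset.mem_univ p), hfp] at hfsum
  have hcard : ((Finset.univ.erase p).card : ℝ) = n - 1 := by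
    rw [Finset.card_erase_of_mem (Finset.mem_univ p), Finset.card_univ, Fintype.card_fin,
      Nat.cast_sub (by omega), Nat.cast_one]
  -- Since `f p = M ^ 2` but the total is at most `M ^ 2 / 2`, averaging yields a `q` whose square
  -- points partly against `x p ^ 2`.
  obtain ⟨q, hq, hfq⟩ := Finset.exists_le_of_sum_le (s := Finset.univ.erase p) (f := f)
    (g := fun _ => -(M ^ 2 / (2 * n))) (by
      obtain ⟨q, hq, -⟩ := Fin.exists_ne_and_ne_of_two_lt p p hn
      exact ⟨q, by simp [hq]⟩) (by
      rw [Finset.sum_const, nsmul_eq_mul, hcard]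
      have : ((n : ℝ) - 1) * -(M ^ 2 / (2 * n)) = -(M ^ 2 / 2) + M ^ 2 / (2 * n) := by
        field_simp; ring
      rw [this]
      have : 0 ≤ M ^ 2 / (2 * n) := by positivity
      nlinarith)
  have hqp : q ≠ p := Finset.ne_of_mem_erase hq
  set X := ‖x q‖ ^ 2 with hX
  have hX0 : 0 ≤ X := by positivity
  have hXM : X ≤ M := hp q (Finset.mem_univ q)
  set d := r ^ 2 / (8 * (n : ℝ) ^ 2) with hd
  have hd0 : 0 ≤ d := by positivity
  have hdM : 4 * n * d ≤ M := by
    have : 4 * n * d = r ^ 2 / (2 * n) := by rw [hd]; field_simp; ring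
    rw [this, div_le_iff₀ (by positivity)]
    linarith
  refine ⟨q, p, hqp, (sq_le_sq₀ (norm_nonneg _) (by nlinarith)).mp ?_⟩
  rw [← Complex.normSq_eq_norm_sq, Complex.normSq_add, Complex.normSq_eq_norm_sq,
    Complex.normSq_eq_norm_sq, norm_pow, norm_pow, ← hX, ← hM]
  change X ^ 2 + M ^ 2 + 2 * f q ≤ _
  have h1 : 2 * f q ≤ -(M ^ 2 / n) := by
    have : M ^ 2 / n = 2 * (M ^ 2 / (2 * n)) := by field_simp
    rw [this]; linarith
  have h2 : 4 * d * M ≤ M ^ 2 / n := by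
    rw [le_div_iff₀ (by linarith)]
    nlinarith
  nlinarith

theorem energy_pt_alt (hij : i ≠ j) {w : List (Fin n)}
    (hw : ∀ k, k ≠ i → k ≠ j → pt a w k = pt a u k) :
    energy (pt a w) = energy (pt a u) - (‖pt a u i‖ ^ 2 + ‖pt a u j‖ ^ 2) +
      (‖pt a w i‖ ^ 2 + ‖pt a w j‖ ^ 2) := by
  rw [energy, energy, ← Finset.sum_add_sum_compl {i, j},
    ← Finset.sum_add_sum_compl {i, j} (fun k => ‖pt a u k‖ ^ 2), Finset.sum_pair hij,
    Finset.sum_pair hij]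
  have : ∑ k ∈ ({i, j} : Finset (Fin n))ᶜ, ‖pt a w k‖ ^ 2 =
      ∑ k ∈ ({i, j} : Finset (Fin n))ᶜ, ‖pt a u k‖ ^ 2 :=
    Finset.sum_congr rfl fun k hk => by
      simp only [Finset.mem_compl, Finset.mem_insert, Finset.mem_singleton, not_or] at hk
      rw [hw k hk.1 hk.2]
  rw [this]
  ring

/-- The quadratic form differs from `x i ^ 2 + x j ^ 2` by at most `r ^ 3`; with `κ = 2 * r` and `θ
= r ^ 3` all errors add up to less than `24 * r ^ 3`. The bound `2 * r` on the coordinates leaves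
room for one preliminary flip. -/
theorem exists_energy_le_sub (hn : 3 ≤ n) (hr : 0 < r) (hr1 : 100 * r ≤ 1)
    (hcut : ∀ γ : AltGeodesic n, extHurwitz a γ ∉ cutInterval) (hij : i ≠ j)
    (hi : Reduced (i :: u)) (hj : Reduced (j :: u)) (hx : ∀ k, ‖pt a u k‖ ≤ 2 * r)
    (hs : ‖pt a u i‖ ^ 2 + ‖pt a u j‖ ^ 2 ≤ r ^ 2) {d : ℝ}
    (hd : ‖pt a u i ^ 2 + pt a u j ^ 2‖ ≤ ‖pt a u i‖ ^ 2 + ‖pt a u j‖ ^ 2 - d) :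
    ∃ w, Reduced w ∧ (w = u ∨ u.length < w.length) ∧
      energy (pt a w) ≤ energy (pt a u) - d + 24 * r ^ 3 := by
  have hcof := norm_cof_le hn (by linarith) hx i j
  have hc := hcut (geod (ev u) hij)
  rw [extHurwitz_geod] at hc
  obtain ⟨m, w, hw, hle⟩ := exists_alt_small hij hc hcof (by linarith)
    (show 0 < r ^ 3 by positivity)
  refine ⟨w, ?_, ?_, ?_⟩
  · cases m with
    | zero => rcases hw with rfl | rfl <;> exact hi.tail
    | succ m =>
      rcases hw with rfl | rfl
      · exact reduced_alt hij hi m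
      · exact reduced_alt hij.symm hj m
  · cases m with
    | zero => exact Or.inl (hw.elim id id)
    | succ m => right; rcases hw with rfl | rfl <;> rw [length_alt] <;> omega
  · rw [energy_pt_alt (u := u) hij (w := w) (by
      intro k hki hkj
      rcases hw with rfl | rfl
      · exact pt_alt_of_ne hki hkj m
      · exact pt_alt_of_ne hkj hki m)]
    set s := ‖pt a u i‖ ^ 2 + ‖pt a u j‖ ^ 2 with hsdef
    have h1 : ‖cof (pt a u) i j * pt a u i * pt a u j‖ ≤ r ^ 3 := by
      rw [norm_mul, norm_mul, mul_assoc]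
      have h2 : ‖pt a u i‖ * ‖pt a u j‖ ≤ r ^ 2 / 2 := by
        nlinarith [sq_nonneg (‖pt a u i‖ - ‖pt a u j‖)]
      calc _ ≤ 2 * r * (r ^ 2 / 2) := mul_le_mul hcof h2 (by positivity) (by positivity)
        _ = r ^ 3 := by ring
    have h2 := norm_sub_le (pt a u i ^ 2 + pt a u j ^ 2) (cof (pt a u) i j * pt a u i * pt a u j)
    have h0 : ‖pt a u i ^ 2 + pt a u j ^ 2‖ ≤ s := by
      refine (norm_add_le _ _).trans ?_
      rw [norm_pow, norm_pow]
    set q := ‖pt a u i ^ 2 + pt a u j ^ 2 - cof (pt a u) i j * pt a u i * pt a u j‖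
    have h3 : r * q ≤ r * (r ^ 2 + r ^ 3) := by gcongr; linarith
    have h4 : r * r ^ 3 ≤ 1 / 100 * r ^ 3 := by gcongr; linarith
    nlinarith

theorem exists_longer_of_energy_le (hn : 3 ≤ n) (hr : 0 < r)
    (hrn : 1000 * (n : ℝ) ^ 2 * r ≤ 1)
    (hcut : ∀ γ : AltGeodesic n, extHurwitz a γ ∉ cutInterval) (hH : ‖hurwitz a‖ ≤ r ^ 3)
    (hu : Reduced u) (h : energy (pt a u) ≤ r ^ 2) :
    ∃ w, Reduced w ∧ u.length < w.length ∧ energy (pt a w) ≤ r ^ 2 := by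
  have hn0 : (3 : ℝ) ≤ n := by exact_mod_cast hn
  have hr1 : 100 * r ≤ 1 := by nlinarith
  have hx := norm_le_of_energy_le hr.le h
  have hr3 : r ^ 3 ≤ r ^ 2 / 100 := by nlinarith [sq_pos_of_pos hr]
  rcases le_or_gt (energy (pt a u)) (r ^ 2 / 2) with h' | h'
  · obtain ⟨k, hk⟩ : ∃ k, Reduced (k :: u) := by
      cases u with
      | nil => exact ⟨⟨0, by omega⟩, List.isChain_singleton _⟩
      | cons p t =>
        obtain ⟨k, hk, -⟩ := Fin.exists_ne_and_ne_of_two_lt p p hn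
        exact ⟨k, List.isChain_cons_cons.mpr ⟨hk, hu⟩⟩
    refine ⟨k :: u, hk, by simp, ?_⟩
    have := energy_flipMap_le hn (by linarith) hx k
    rw [pt]
    linarith
  · obtain ⟨i, j, hij, hd⟩ := exists_norm_sq_add_sq_le hn hr hrn (by rwa [hurwitz_pt]) h h'
    set d := r ^ 2 / (8 * (n : ℝ) ^ 2)
    -- The gain `d` beats the error `24 * r ^ 3` together with the cost `3 * r ^ 3` of a preliminary
    -- flip.
    have hdr : 125 * r ^ 3 ≤ d := by
      rw [le_div_iff₀ (by positivity)]
      nlinarith [sq_pos_of_pos hr]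
    have hr3' : 0 < r ^ 3 := by positivity
    have hs : ‖pt a u i‖ ^ 2 + ‖pt a u j‖ ^ 2 ≤ r ^ 2 := by
      refine le_trans ?_ h
      rw [← Finset.sum_pair hij (f := fun k => ‖pt a u k‖ ^ 2)]
      exact Finset.sum_le_sum_of_subset_of_nonneg (Finset.subset_univ _)
        fun _ _ _ => by positivity
    by_cases hhead : Reduced (i :: u) ∧ Reduced (j :: u)
    · obtain ⟨w, hw, hwu, hle⟩ := exists_energy_le_sub hn hr hr1 hcut hij hhead.1 hhead.2
        (fun k => (hx k).trans (by linarith)) hs hd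
      refine ⟨w, hw, hwu.resolve_left ?_, by linarith⟩
      rintro rfl
      linarith
    -- The word starts with `i` or `j`, so moving along the geodesic might shorten it; a preliminary
    -- flip at a third label makes both directions lengthen it and leaves the two coordinates
    -- unchanged.
    · obtain ⟨k, hki, hkj⟩ := Fin.exists_ne_and_ne_of_two_lt i j hn
      have hk : Reduced (k :: u) := by
        cases u with
        | nil => exact List.isChain_singleton _
        | cons p t =>
          refine List.isChain_cons_cons.mpr ⟨?_, hu⟩
          rintro rfl
          exact hhead ⟨List.isChain_cons_cons.mpr ⟨hki.symm, hu⟩,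
            List.isChain_cons_cons.mpr ⟨hkj.symm, hu⟩⟩
      have e1 : pt a (k :: u) i = pt a u i := flipMap_of_ne _ hki.symm
      have e2 : pt a (k :: u) j = pt a u j := flipMap_of_ne _ hkj.symm
      have hE := energy_flipMap_le hn (by linarith) hx k
      have hx' : ∀ q, ‖pt a (k :: u) q‖ ≤ 2 * r := by
        refine norm_le_of_energy_le (by linarith) (hE.trans ?_)
        nlinarith
      obtain ⟨w, hw, hwu, hle⟩ := exists_energy_le_sub (u := k :: u) hn hr hr1 hcut hij
        (List.isChain_cons_cons.mpr ⟨hki.symm, hk⟩) (List.isChain_cons_cons.mpr ⟨hkj.symm, hk⟩)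
        hx' (by rwa [e1, e2]) (by rwa [e1, e2])
      refine ⟨w, hw, ?_, ?_⟩
      · rcases hwu with rfl | hwu
        · simp
        · rw [List.length_cons] at hwu; omega
      · rw [pt] at hle
        linarith

theorem zero_notMem_closure_bowditchDomain (hn : 3 ≤ n) :
    (0 : Fin n → ℂ) ∉ closure (bowditchDomain n) := by
  have hn0 : (0 : ℝ) < n := by exact_mod_cast (by omega : 0 < n)
  set r : ℝ := 1 / (1000 * (n : ℝ) ^ 2) with hrdef
  have hr : 0 < r := by positivity
  have hrn : 1000 * (n : ℝ) ^ 2 * r ≤ 1 := by rw [hrdef, mul_one_div_cancel (by positivity)]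
  have hz : (Finset.univ : Finset (Fin n)).Nonempty := ⟨⟨0, by omega⟩, Finset.mem_univ _⟩
  have h1 : ∀ᶠ a : Fin n → ℂ in nhds 0, ‖hurwitz a‖ < r ^ 3 := by
    have hcont : Continuous fun a : Fin n → ℂ => ‖hurwitz a‖ := by
      unfold hurwitz; fun_prop
    refine hcont.continuousAt.eventually_lt_const ?_
    obtain ⟨k, hk⟩ := hz
    simpa [hurwitz_eq _ k] using pow_pos hr 3
  have h2 : ∀ᶠ a : Fin n → ℂ in nhds 0, energy a < r ^ 2 := by
    have hcont : Continuous fun a : Fin n → ℂ => energy a := by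
      unfold energy; fun_prop
    refine hcont.continuousAt.eventually_lt_const ?_
    simpa [energy] using pow_pos hr 2
  intro hcl
  obtain ⟨a, ⟨ha1, ha2⟩, ha⟩ := mem_closure_iff_nhds.mp hcl _ (h1.and h2)
  -- Only finitely many orbit points of `a` lie in the ball of radius `r`, so there is a longest
  -- word with small energy, which `exists_longer_of_energy_le` then extends.
  have hfin := finite_setOf_norm_vecHurwitz_le hn (Set.singleton_subset_iff.mpr ha)
    isCompact_singleton r
  have hS : {w : List (Fin n) | Reduced w ∧ energy (pt a w) ≤ r ^ 2}.Finite := by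
    refine (hfin.image nf).subset fun w hw => ⟨ev w, ⟨a, rfl, ?_⟩, nf_ev hw.1⟩
    rw [vecHurwitz_ev]
    exact (pi_norm_le_iff_of_nonneg hr.le).mpr (norm_le_of_energy_le hr.le hw.2)
  obtain ⟨u, ⟨hu, hE⟩, hmax⟩ := Set.exists_max_image _ List.length hS
    ⟨[], List.isChain_nil, ha2.le⟩
  obtain ⟨w, hw, hlen, hEw⟩ := exists_longer_of_energy_le hn hr hrn ha.1 ha1.le hu hE
  exact absurd (hmax w ⟨hw, hEw⟩) (not_le.mpr hlen)

end MarkoffHurwitz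

theorem theorem1p4 (n : ℕ) (hn : 3 ≤ n) :
    (MarkoffHurwitz.bowditchDomain n).Nonempty ∧
    IsOpen (MarkoffHurwitz.bowditchDomain n) ∧
    (∀ g : MarkoffHurwitz.Gam n,
      (fun x : Fin n → ℂ => g • x) '' MarkoffHurwitz.bowditchDomain n =
        MarkoffHurwitz.bowditchDomain n) ∧
    (∀ C : Set (Fin n → ℂ), C ⊆ MarkoffHurwitz.bowditchDomain n → IsCompact C →
      {g : MarkoffHurwitz.Gam n |
        ((fun x : Fin n → ℂ => g • x) '' C ∩ C).Nonempty}.Finite) ∧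
    (0 : Fin n → ℂ) ∉ closure (MarkoffHurwitz.bowditchDomain n) :=
  ⟨MarkoffHurwitz.bowditchDomain_nonempty hn, MarkoffHurwitz.isOpen_bowditchDomain hn,
    MarkoffHurwitz.image_smul_bowditchDomain,
    fun _ hC hcomp => MarkoffHurwitz.finite_setOf_inter_nonempty hn hC hcomp,
    MarkoffHurwitz.zero_notMem_closure_bowditchDomain hn⟩
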